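/- Let $S^2$ be the unit sphere with its round metric $g$, its unique spin structure and spinor bundle, Levi-Civita spin connection $\nabla$, chirality operator $\Gamma$ ($\Gamma^2=1$), Dirac operator $D=\sum_i v_i\cdot\nabla_{v_i}$ ($v_1,v_2$ a local orthonormal frame, Clifford multiplication with $v\cdot v\cdot=-|v|^2$), and $L^2$ product $\langle\cdot,\cdot\rangle$ of spinors. For a smooth vector field $X$ on $S^2$ let $$\mathscr L_X\psi=\nabla_X\psi-\tfrac18\sum_{i,j}\big[g(\nabla_{v_i}X,v_j)-g(\nabla_{v_j}X,v_i)\big]\,v_i\cdot v_j\cdot\psi$$ be the Kosmann-Lichnerowicz derivative of spinors. Write $\psi^\pm=\frac12(1\pm\Gamma)\psi$, let $V_m$ be the space of smooth spinors with $D\psi=m\psi$, let $V_{m>0}=\bigoplus_{m>0}V_m$, and $V_0^\pm=\{\psi\in V_0:\Gamma\psi=\pm\psi\}$. One says that $\mathscr L_X$ has strong chiral symmetry if 1. $\langle\phi^+,\mathscr L_X\psi^+\rangle=\langle\phi^-,\mathscr L_X\psi^-\rangle$ for all $\phi,\psi\in V_{m>0}$; 2. $\mathscr L_X$ maps $V_0=\ker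 D$ into itself; 3. there is a unitary linear isomorphism $\Theta_0:V_0^+\to V_0^-$, equivariant under the action on spinors of the double cover $SU(2)$ of the connected isometry group $SO(3)$, such that $\langle\phi,\mathscr L_X\psi\rangle=\langle\Theta_0\phi,\mathscr L_X\Theta_0\psi\rangle$ for all $\phi,\psi\in V_0^+$. Then, for a generic smooth divergence-free vector field $X$ on $S^2$, the derivative $\mathscr L_X$ does not have strong chiral symmetry. More precisely: $\mathscr L_X$ does not have strong chiral symmetry for any smooth divergence-free vector field $X$ that is not a Killing field, and the non-Killing fields form an open and dense subset of the space of all smooth divergence-free vector fields on $S^2$ with the $C^\infty$ topology. -/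

import Mathlib

/-!
Spin geometry of the round unit sphere `S² ⊂ ℝ³`.

Conventions.  Clifford multiplication by a vector squares to minus its squared length; the
`2`-dimensional gamma matrices are `γ_a = -i σ_a`; the Hermitian product is antilinear in the first
entry.

The spin structure is the principal `U(1)`-bundle `SU(2) → S²`, `U ↦ U σ₃ U*`, with the double
cover `U ↦ (U σ₁ U*, U σ₂ U*)` onto the bundle of oriented orthonormal frames (here `ℝ³` is
identified with the traceless Hermitian `2 × 2` matrices).  The class in `SU(2) ×_{U(1)} ℂ²` of a
pair `(U, s)` is identified with the pair `(U σ₃ U*, U s)`; so the spinor bundle is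
`S² × ℂ²`, and a spinor field is a map `ψ : S² → ℂ²`, whose representative in the local
trivialization given by a local spin frame `U` is `U* ψ`.
-/

open scoped Manifold ContDiff

noncomputable section

namespace SphereSpin

/-- Euclidean three-space. -/
abbrev E3 : Type := EuclideanSpace ℝ (Fin 3)

/-- The round unit sphere. -/
abbrev S2 : Type := Metric.sphere (0 : E3) 1

/-- The fibre `ℂ²` of the spinor bundle, with its standard Hermitian product. -/
abbrev Spinor : Type := EuclideanSpace ℂ (Fin 2)

/-! ### Calculus on the sphere -/

/-- The tangent plane of the sphere at `p`, as a plane in `ℝ³`; it carries the round metric. -/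
def tangent (p : S2) : Submodule ℝ E3 := (Submodule.span ℝ {(p : E3)})ᗮ

theorem normalize_mem {x : E3} (hx : x ≠ 0) : ‖x‖⁻¹ • x ∈ Metric.sphere (0 : E3) 1 := by
  simp [norm_smul, norm_ne_zero_iff.mpr hx]

/-- The extension of a function on the sphere to `ℝ³ ∖ {0}` that is constant along rays. -/
def radialExt {F : Type*} [Zero F] (f : S2 → F) (x : E3) : F :=
  open Classical in if hx : x ≠ 0 then f ⟨‖x‖⁻¹ • x, normalize_mem hx⟩ else 0

/-- Directional derivative of a function on the sphere at `p` along a tangent vector `v`. -/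
def dirDeriv {F : Type*} [NormedAddCommGroup F] [NormedSpace ℝ F]
    (f : S2 → F) (p : S2) (v : E3) : F :=
  fderiv ℝ (radialExt f) (p : E3) v

/-- Smooth maps from the sphere to a normed space. -/
def IsSmooth {F : Type*} [NormedAddCommGroup F] [NormedSpace ℝ F] (f : S2 → F) : Prop :=
  ContMDiff (𝓡 2) 𝓘(ℝ, F) ∞ f

/-- A chosen orthonormal basis of the tangent plane at `p`.  The expressions in which it is used
do not depend on the choice. -/
def frame (p : S2) : OrthonormalBasis (Fin (Module.finrank ℝ (tangent p))) ℝ (tangent p) :=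
  stdOrthonormalBasis ℝ (tangent p)

/-- The Levi-Civita connection: `∇_v X` is the tangential part of the derivative of `X` along
`v`. -/
def covDeriv (X : S2 → E3) (p : S2) (v : E3) : E3 :=
  (tangent p).starProjection (dirDeriv X p v)

/-- The divergence of a tangent vector field. -/
def divergence (X : S2 → E3) (p : S2) : ℝ :=
  ∑ i, inner ℝ (covDeriv X p (frame p i)) (frame p i : E3)

/-- `X` is a Killing field: the Lie derivative of the metric along `X` vanishes. -/
def IsKilling (X : S2 → E3) : Prop :=
  ∀ p : S2, ∀ u ∈ tangent p, ∀ v ∈ tangent p,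
    inner ℝ (covDeriv X p u) v + inner ℝ u (covDeriv X p v) = 0

/-! ### Divergence-free vector fields with the `C^∞` topology -/

/-- Smooth divergence-free tangent vector fields on the sphere. -/
structure DivFreeField where
  toFun : S2 → E3
  tangent' : ∀ p, toFun p ∈ tangent p
  smooth' : IsSmooth toFun
  divFree' : ∀ p, divergence toFun p = 0

/-- The `C^∞` topology: uniform convergence on the sphere of the derivatives of every order. -/
instance : TopologicalSpace DivFreeField :=
  TopologicalSpace.induced
    (fun (X : DivFreeField) (k : ℕ) =>
      UniformFun.ofFun (fun p : S2 => iteratedFDeriv ℝ k (radialExt X.toFun) (p : E3)))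
    inferInstance

/-! ### Spinors -/

/-- The Pauli matrix `x₁ σ₁ + x₂ σ₂ + x₃ σ₃` of a vector in `ℝ³`. -/
def pauli (x : E3) : Matrix (Fin 2) (Fin 2) ℂ :=
  !![(x 2 : ℂ), (x 0 : ℂ) - Complex.I * (x 1 : ℂ);
     (x 0 : ℂ) + Complex.I * (x 1 : ℂ), -(x 2 : ℂ)]

/-- Clifford multiplication `v · s = -i σ(v) s`.  (It is also used for the unit normal, in the
formula for the spin connection.) -/
def cliff (v : E3) : Spinor →ₗ[ℂ] Spinor := (-Complex.I) • Matrix.toEuclideanLin (pauli v)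

/-- The chirality operator; it is `i v₁ · v₂ ·` for every oriented orthonormal basis
`(v₁, v₂)` of the tangent plane, see `chirality_eq`. -/
def chirality (ψ : S2 → Spinor) (p : S2) : Spinor := Matrix.toEuclideanLin (pauli p) (ψ p)

/-- The positive chirality part `(1 + Γ) ψ / 2`. -/
def plusPart (ψ : S2 → Spinor) : S2 → Spinor := (1 / 2 : ℂ) • (ψ + chirality ψ)

/-- The negative chirality part `(1 - Γ) ψ / 2`. -/
def minusPart (ψ : S2 → Spinor) : S2 → Spinor := (1 / 2 : ℂ) • (ψ - chirality ψ)

/-- The Levi-Civita spin connection in the global trivialization `S² × ℂ²` of the spinor bundle.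
In the local trivialization given by a spin frame it is the usual expression
`∂_v + ¼ ∑ g(∇_v v_i, v_j) γ_i γ_j`, see `spinDeriv_eq_local`. -/
def spinDeriv (ψ : S2 → Spinor) (p : S2) (v : E3) : Spinor :=
  dirDeriv ψ p v + (1 / 2 : ℂ) • cliff v (cliff p (ψ p))

/-- The Dirac operator `∑ v_i · ∇_{v_i}`. -/
def dirac (ψ : S2 → Spinor) (p : S2) : Spinor :=
  ∑ i, cliff (frame p i) (spinDeriv ψ p (frame p i))

/-- The Kosmann-Lichnerowicz derivative
`∇_X ψ - ⅛ ∑ (g(∇_{v_i} X, v_j) - g(∇_{v_j} X, v_i)) v_i · v_j · ψ`. -/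
def kosmann (X : S2 → E3) (ψ : S2 → Spinor) (p : S2) : Spinor :=
  spinDeriv ψ p (X p) - (1 / 8 : ℂ) • ∑ i, ∑ j,
    ((inner ℝ (covDeriv X p (frame p i)) (frame p j : E3)
      - inner ℝ (covDeriv X p (frame p j)) (frame p i : E3) : ℝ) : ℂ) •
        cliff (frame p i) (cliff (frame p j) (ψ p))

/-- The `L²` product of spinors for the area measure of the sphere (of total mass `4π`). -/
def l2inner (φ ψ : S2 → Spinor) : ℂ :=
  ∫ p, inner ℂ (φ p) (ψ p) ∂((MeasureTheory.volume : MeasureTheory.Measure E3).toSphere)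

/-! ### Linearity of the Dirac operator -/

theorem IsSmooth.differentiableAt_radialExt {F : Type*} [NormedAddCommGroup F] [NormedSpace ℝ F]
    {f : S2 → F} (hf : IsSmooth f) (p : S2) : DifferentiableAt ℝ (radialExt f) (p : E3) := by
  let O : TopologicalSpace.Opens E3 := ⟨{0}ᶜ, isOpen_compl_singleton⟩
  have hp : (p : E3) ∈ O := by
    have : ‖(p : E3)‖ = 1 := by simp
    intro h
    rw [Set.mem_singleton_iff] at h
    rw [h] at this
    simp at this
  have h1 : ContMDiff 𝓘(ℝ, E3) 𝓘(ℝ, E3) ∞ (fun x : O => ‖(x : E3)‖⁻¹ • (x : E3)) := by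
    intro x
    have hx : (x : E3) ≠ 0 := x.2
    have : ContDiffAt ℝ ∞ (fun x : E3 => ‖x‖⁻¹ • x) (x : E3) :=
      ((contDiffAt_norm ℝ hx).inv (norm_ne_zero_iff.mpr hx)).smul contDiffAt_id
    exact (this.contMDiffAt).comp x contMDiff_subtype_val.contMDiffAt
  have : Fact (Module.finrank ℝ E3 = 2 + 1) := ⟨by simp⟩
  have h2 := h1.codRestrict_sphere (n := 2) (fun x => normalize_mem x.2)
  have h3 : ContMDiffAt 𝓘(ℝ, E3) 𝓘(ℝ, F) ∞ (fun x : O => radialExt f x) ⟨p, hp⟩ := by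
    have := (ContMDiff.comp hf h2).contMDiffAt (x := ⟨p, hp⟩)
    refine this.congr_of_eventuallyEq (Filter.Eventually.of_forall fun x => ?_)
    have hx : (x : E3) ≠ 0 := x.2
    simp only [radialExt, dif_pos hx]
    rfl
  have h4 : ContMDiffAt 𝓘(ℝ, E3) 𝓘(ℝ, F) ∞ (radialExt f) (p : E3) :=
    (contMDiffAt_subtype_iff (x := (⟨p, hp⟩ : O))).mp h3
  exact (contMDiffAt_iff_contDiffAt.mp h4).differentiableAt (by simp)

theorem radialExt_add {F : Type*} [NormedAddCommGroup F] (f g : S2 → F) :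
    radialExt (f + g) = radialExt f + radialExt g := by
  ext x; by_cases hx : x ≠ 0 <;> simp [radialExt, hx]

theorem radialExt_smul {F : Type*} [NormedAddCommGroup F] [NormedSpace ℂ F] (c : ℂ) (f : S2 → F) :
    radialExt (c • f) = c • radialExt f := by
  ext x; by_cases hx : x ≠ 0 <;> simp [radialExt, hx]

theorem dirac_add {φ ψ : S2 → Spinor} (hφ : IsSmooth φ) (hψ : IsSmooth ψ) :
    dirac (φ + ψ) = dirac φ + dirac ψ := by
  funext p
  simp only [dirac, spinDeriv, dirDeriv, radialExt_add, Pi.add_apply,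
    fderiv_add (hφ.differentiableAt_radialExt p) (hψ.differentiableAt_radialExt p),
    _root_.add_apply, map_add, smul_add, ← Finset.sum_add_distrib]
  exact Finset.sum_congr rfl fun i _ => by abel

theorem dirac_smul (c : ℂ) {ψ : S2 → Spinor} (hψ : IsSmooth ψ) :
    dirac (c • ψ) = c • dirac ψ := by
  funext p
  simp only [dirac, spinDeriv, dirDeriv, radialExt_smul, Pi.smul_apply,
    fderiv_const_smul (hψ.differentiableAt_radialExt p), _root_.smul_apply,
    map_add, map_smul, smul_add, Finset.smul_sum]
  exact Finset.sum_congr rfl fun i _ => by rw [smul_comm c (1 / 2 : ℂ)]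

theorem dirac_zero : dirac (0 : S2 → Spinor) = 0 := by
  have h : IsSmooth (0 : S2 → Spinor) := contMDiff_const
  simpa using dirac_smul (0 : ℂ) h

/-! ### Eigenspaces of the Dirac operator -/

/-- The space `V_m` of smooth spinors with `D ψ = m ψ`. -/
def eigenspace (m : ℝ) : Submodule ℂ (S2 → Spinor) where
  carrier := {ψ | IsSmooth ψ ∧ dirac ψ = (m : ℂ) • ψ}
  add_mem' := by
    rintro φ ψ ⟨h1, h2⟩ ⟨h3, h4⟩
    exact ⟨ContMDiff.add h1 h3, by rw [dirac_add h1 h3, h2, h4, smul_add]⟩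
  zero_mem' := ⟨contMDiff_const, by rw [dirac_zero, smul_zero]⟩
  smul_mem' := by
    rintro c ψ ⟨h1, h2⟩
    refine ⟨?_, by rw [dirac_smul c h1, h2, smul_comm]⟩
    have h3 : ContDiff ℝ ∞ (fun s : Spinor => c • s) := contDiff_const_smul c
    exact h3.contMDiff.comp h1

/-- The direct sum `V_{m>0}` of the eigenspaces with positive eigenvalue. -/
def positiveSpace : Submodule ℂ (S2 → Spinor) := ⨆ (m : ℝ) (_ : 0 < m), eigenspace m

theorem chirality_add (φ ψ : S2 → Spinor) :
    chirality (φ + ψ) = chirality φ + chirality ψ := by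
  funext p; simp [chirality]

theorem chirality_smul (c : ℂ) (ψ : S2 → Spinor) : chirality (c • ψ) = c • chirality ψ := by
  funext p; simp [chirality]

/-- The chiral part `{ψ ∈ V_0 : Γ ψ = ε ψ}` of the kernel `V_0` of the Dirac operator, for
`ε = ±1`. -/
def chiralKernel (ε : ℂ) : Submodule ℂ (S2 → Spinor) where
  carrier := {ψ | ψ ∈ eigenspace 0 ∧ chirality ψ = ε • ψ}
  add_mem' := by
    rintro φ ψ ⟨h1, h2⟩ ⟨h3, h4⟩
    exact ⟨add_mem h1 h3, by rw [chirality_add, h2, h4, smul_add]⟩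
  zero_mem' := ⟨zero_mem _, by funext p; simp [chirality]⟩
  smul_mem' := by
    rintro c ψ ⟨h1, h2⟩
    exact ⟨Submodule.smul_mem _ c h1, by rw [chirality_smul, h2, smul_comm]⟩

/-! ### The action of the isometries

The connected isometry group `SO(3)` acts on spinors through its double cover `SU(2)`. -/

/-- The vector with a given traceless Hermitian matrix as Pauli matrix. -/
def unpauli (M : Matrix (Fin 2) (Fin 2) ℂ) : E3 := !₂[(M 1 0).re, (M 1 0).im, (M 0 0).re]

theorem pauli_unpauli {M : Matrix (Fin 2) (Fin 2) ℂ} (h : M.IsHermitian) (ht : M.trace = 0) :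
    pauli (unpauli M) = M := by
  have h00 := h.apply 0 0
  have h01 := h.apply 0 1
  simp only [Matrix.trace_fin_two] at ht
  have h11 : M 1 1 = -M 0 0 := by linear_combination ht
  ext i j
  fin_cases i <;> fin_cases j <;>
    simp only [Complex.ext_iff] at h00 h01 ⊢ <;>
    simp [pauli, unpauli, h11] at h00 h01 ⊢ <;> (try constructor) <;> linarith

theorem det_pauli (x : E3) : (pauli x).det = -((‖x‖ ^ 2 : ℝ) : ℂ) := by
  rw [EuclideanSpace.norm_sq_eq]
  simp only [pauli, Matrix.det_fin_two_of, Fin.sum_univ_three, Real.norm_eq_abs, sq_abs]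
  push_cast
  linear_combination ((x 1 : ℂ) ^ 2) * Complex.I_sq

theorem pauli_isHermitian (x : E3) : (pauli x).IsHermitian := by
  ext i j
  fin_cases i <;> fin_cases j <;> simp [pauli, Complex.ext_iff]

/-- The rotation of `ℝ³` determined by `g ∈ SU(2)`, `σ(x) ↦ g σ(x) g*`. -/
def rotVec (g : Matrix.specialUnitaryGroup (Fin 2) ℂ) (x : E3) : E3 :=
  unpauli ((g : Matrix (Fin 2) (Fin 2) ℂ) * pauli x * star (g : Matrix (Fin 2) (Fin 2) ℂ))

theorem pauli_rotVec (g : Matrix.specialUnitaryGroup (Fin 2) ℂ) (x : E3) :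
    pauli (rotVec g x)
      = (g : Matrix (Fin 2) (Fin 2) ℂ) * pauli x * star (g : Matrix (Fin 2) (Fin 2) ℂ) := by
  have hs : star (g : Matrix (Fin 2) (Fin 2) ℂ) * (g : Matrix (Fin 2) (Fin 2) ℂ) = 1 :=
    Matrix.mem_unitaryGroup_iff'.mp (Matrix.mem_specialUnitaryGroup_iff.mp g.2).1
  refine pauli_unpauli ?_ ?_
  · rw [Matrix.star_eq_conjTranspose]
    exact Matrix.isHermitian_mul_mul_conjTranspose _ (pauli_isHermitian x)
  · rw [Matrix.trace_mul_comm, ← mul_assoc, hs, one_mul]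
    simp [pauli, Matrix.trace_fin_two]

theorem rotate_mem (g : Matrix.specialUnitaryGroup (Fin 2) ℂ) (p : S2) :
    rotVec g p ∈ Metric.sphere (0 : E3) 1 := by
  have hs : star (g : Matrix (Fin 2) (Fin 2) ℂ) * (g : Matrix (Fin 2) (Fin 2) ℂ) = 1 :=
    Matrix.mem_unitaryGroup_iff'.mp (Matrix.mem_specialUnitaryGroup_iff.mp g.2).1
  have hp : ‖(p : E3)‖ = 1 := by simp
  have hd := det_pauli (rotVec g p)
  have hd2 : (g : Matrix (Fin 2) (Fin 2) ℂ).det * (star (g : Matrix (Fin 2) (Fin 2) ℂ)).det = 1 := by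
    rw [mul_comm, ← Matrix.det_mul, hs, Matrix.det_one]
  rw [pauli_rotVec, Matrix.det_mul, Matrix.det_mul, mul_right_comm, hd2, one_mul,
    det_pauli, hp] at hd
  have h2 : ((1 : ℝ) ^ 2 : ℝ) = ‖rotVec g p‖ ^ 2 := by exact_mod_cast neg_injective hd
  have h3 : ‖rotVec g p‖ = 1 := by
    nlinarith [norm_nonneg (rotVec g p)]
  simpa using h3

/-- The rotation of the sphere determined by `g ∈ SU(2)`. -/
def rotate (g : Matrix.specialUnitaryGroup (Fin 2) ℂ) (p : S2) : S2 :=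
  ⟨rotVec g p, rotate_mem g p⟩

/-- The action of `g ∈ SU(2)` on spinor fields, `(g ψ)(p) = g ψ(g⁻¹ p)`. -/
def spinAct (g : Matrix.specialUnitaryGroup (Fin 2) ℂ) (ψ : S2 → Spinor) (p : S2) : Spinor :=
  Matrix.toEuclideanLin (g : Matrix (Fin 2) (Fin 2) ℂ) (ψ (rotate g⁻¹ p))

/-! ### Comparison with local spin frames -/

theorem pauli_mul_pauli (u v w : E3) (h : crossProduct (u : Fin 3 → ℝ) v = (w : Fin 3 → ℝ)) :
    pauli u * pauli v = ((inner ℝ u v : ℝ) : ℂ) • (1 : Matrix (Fin 2) (Fin 2) ℂ)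
      + Complex.I • pauli w := by
  have h0 := congrFun h 0
  have h1 := congrFun h 1
  have h2 := congrFun h 2
  simp [cross_apply] at h0 h1 h2
  have hI := Complex.I_sq
  ext i j
  fin_cases i <;> fin_cases j <;>
    simp [pauli, PiLp.inner_apply, Fin.sum_univ_three, ← h0, ← h1, ← h2] <;> ring_nf <;>
    simp [hI] <;> ring

theorem toLin_mul (A B : Matrix (Fin 2) (Fin 2) ℂ) (s : Spinor) :
    Matrix.toEuclideanLin (A * B) s = Matrix.toEuclideanLin A (Matrix.toEuclideanLin B s) := by
  apply (WithLp.ofLp_injective 2)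
  exact (Matrix.mulVec_mulVec s.ofLp A B).symm

/-- If `(u, v)` is an oriented orthonormal basis of the tangent plane at `p`, then
`Γ ψ = i u · v · ψ` at `p`. -/
theorem chirality_eq (ψ : S2 → Spinor) (p : S2) (u v : E3) (huv : inner ℝ u v = 0)
    (h : crossProduct (u : Fin 3 → ℝ) v = ((p : E3) : Fin 3 → ℝ)) :
    chirality ψ p = Complex.I • cliff u (cliff v (ψ p)) := by
  have h1 := pauli_mul_pauli u v p h
  rw [huv] at h1
  have h2 : Matrix.toEuclideanLin (pauli u) (Matrix.toEuclideanLin (pauli v) (ψ p))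
      = Matrix.toEuclideanLin (pauli u * pauli v) (ψ p) := by
    rw [toLin_mul]
  simp only [chirality, cliff, LinearMap.smul_apply, map_smul, h2, h1]
  simp only [Complex.ofReal_zero, zero_smul, zero_add, map_smul, LinearMap.smul_apply, smul_smul]
  simp

section Local

open scoped Matrix.Norms.L2Operator

/-- `pauli` as a real linear map. -/
def pauliL : E3 →L[ℝ] Matrix (Fin 2) (Fin 2) ℂ :=
  LinearMap.toContinuousLinearMap
    { toFun := pauli
      map_add' := fun x y => by
        ext i j; fin_cases i <;> fin_cases j <;> simp [pauli] <;> ring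
      map_smul' := fun c x => by
        ext i j; fin_cases i <;> fin_cases j <;> simp [pauli] <;> ring }

/-- `unpauli` as a real linear map. -/
def unpauliL : Matrix (Fin 2) (Fin 2) ℂ →L[ℝ] E3 :=
  LinearMap.toContinuousLinearMap
    { toFun := unpauli
      map_add' := fun x y => by
        ext i; fin_cases i <;> simp [unpauli]
      map_smul' := fun c x => by
        ext i; fin_cases i <;> simp [unpauli] }

theorem unpauli_pauli (x : E3) : unpauli (pauli x) = x := by
  ext i; fin_cases i <;> simp [unpauli, pauli]

theorem inner_eq_trace (x y : E3) :
    ((inner ℝ x y : ℝ) : ℂ) = (1 / 2 : ℂ) * (pauli x * pauli y).trace := by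
  have hI := Complex.I_sq
  simp [pauli, Matrix.trace_fin_two, PiLp.inner_apply, Fin.sum_univ_three]
  ring_nf
  simp [hI]
  try ring

theorem ne_zero_add {p : S2} {v : E3} (hv : v ∈ tangent p) (t : ℝ) : (p : E3) + t • v ≠ 0 := by
  have hp : ‖(p : E3)‖ = 1 := by simp
  have h0 : inner ℝ (p : E3) v = 0 := by
    rw [tangent, Submodule.mem_orthogonal_singleton_iff_inner_right] at hv
    exact hv
  intro h
  have := congrArg (fun w => inner ℝ (p : E3) w) h
  simp [inner_add_right, inner_smul_right, h0, hp] at this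

/-- A curve on the sphere through `p` with velocity `v`. -/
def curve (p : S2) (v : tangent p) (t : ℝ) : S2 :=
  ⟨‖(p : E3) + t • (v : E3)‖⁻¹ • ((p : E3) + t • (v : E3)), normalize_mem (ne_zero_add v.2 t)⟩

theorem curve_zero (p : S2) (v : tangent p) : curve p v 0 = p := by
  apply Subtype.ext; simp [curve]

theorem hasDerivAt_dirDeriv {F : Type*} [NormedAddCommGroup F] [NormedSpace ℝ F] {f : S2 → F}
    {p : S2} (hf : DifferentiableAt ℝ (radialExt f) (p : E3)) (v : tangent p) :
    HasDerivAt (fun t => f (curve p v t)) (dirDeriv f p v) 0 := by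
  have h1 : HasDerivAt (fun t : ℝ => (p : E3) + t • (v : E3)) (v : E3) 0 := by
    simpa using ((hasDerivAt_id (0 : ℝ)).smul_const (v : E3)).const_add (p : E3)
  have h2 : HasFDerivAt (radialExt f) (fderiv ℝ (radialExt f) (p : E3))
      ((p : E3) + (0 : ℝ) • (v : E3)) := by
    simpa using hf.hasFDerivAt
  have h3 := h2.comp_hasDerivAt (0 : ℝ) h1
  refine h3.congr_of_eventuallyEq (Filter.Eventually.of_forall fun t => ?_)
  simp only [Function.comp, radialExt, dif_pos (ne_zero_add v.2 t)]
  rfl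

theorem hasDerivAt_curve (p : S2) (v : tangent p) :
    HasDerivAt (fun t => (curve p v t : E3)) (v : E3) 0 := by
  have h0 : inner ℝ (p : E3) (v : E3) = 0 := by
    exact Submodule.mem_orthogonal_singleton_iff_inner_right.mp v.2
  have hp : ‖(p : E3)‖ = 1 := by simp
  have h1 : HasDerivAt (fun t : ℝ => (p : E3) + t • (v : E3)) (v : E3) 0 := by
    simpa using ((hasDerivAt_id (0 : ℝ)).smul_const (v : E3)).const_add (p : E3)
  have h2 : HasDerivAt (fun t : ℝ => ‖(p : E3) + t • (v : E3)‖ ^ 2) 0 0 := by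
    have := h1.norm_sq
    simpa [h0] using this
  have h3 : HasDerivAt (fun t : ℝ => ‖(p : E3) + t • (v : E3)‖) 0 0 := by
    have := h2.sqrt (by simp [hp])
    simpa using this
  have h4 : HasDerivAt (fun t : ℝ => ‖(p : E3) + t • (v : E3)‖⁻¹) 0 0 := by
    have := h3.fun_inv (by simp [hp])
    simpa using this
  have := h4.fun_smul h1
  simpa only [curve, hp, zero_smul, add_zero, inv_one, one_smul] using this

theorem radialExt_comp {F G : Type*} [Zero F] [Zero G] (f : S2 → F) (k : F → G) (p : S2) :
    radialExt (fun q => k (f q)) =ᶠ[nhds (p : E3)] fun x => k (radialExt f x) := by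
  have hp : (p : E3) ≠ 0 := by
    intro h
    have : ‖(p : E3)‖ = 1 := by simp
    simp [h] at this
  filter_upwards [isOpen_compl_singleton.mem_nhds hp] with x hx
  have hx : x ≠ 0 := hx
  simp [radialExt, hx]

/-- The standard basis `E₁, E₂, E₃` of `ℝ³`. -/
def stdVec (i : Fin 3) : E3 := EuclideanSpace.single i 1

theorem traceless_anticomm {A B : Matrix (Fin 2) (Fin 2) ℂ} (hA : A.trace = 0) (hB : B.trace = 0) :
    A * B + B * A = (A * B).trace • (1 : Matrix (Fin 2) (Fin 2) ℂ) := by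
  rw [Matrix.trace_fin_two] at hA hB
  have h1 : A 1 1 = -A 0 0 := by linear_combination hA
  have h2 : B 1 1 = -B 0 0 := by linear_combination hB
  ext i j
  fin_cases i <;> fin_cases j <;>
    simp [Matrix.mul_apply, Matrix.trace_fin_two, h1, h2] <;> ring

/-- In the trivialization of the spinor bundle given by a local spin frame `U` (a local section of
`SU(2) → S²`), with frame vectors `v₁ = U E₁`, `v₂ = U E₂`, the spin connection is
`∂_v + ¼ ∑ g(∇_v v_i, v_j) γ_i γ_j`. -/
theorem spinDeriv_eq_local (U : S2 → Matrix.specialUnitaryGroup (Fin 2) ℂ) (p : S2)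
    (hU : ∀ᶠ q in nhds p, rotVec (U q) (stdVec 2) = q)
    (hd : ∀ i j, DifferentiableAt ℝ
      (radialExt fun q => (U q : Matrix (Fin 2) (Fin 2) ℂ) i j) (p : E3))
    (ψ : S2 → Spinor) (hψ : DifferentiableAt ℝ (radialExt ψ) (p : E3))
    (v : E3) (hv : v ∈ tangent p) :
    spinDeriv ψ p v = Matrix.toEuclideanLin (U p : Matrix (Fin 2) (Fin 2) ℂ)
      (dirDeriv (fun q => Matrix.toEuclideanLin
          (star (U q : Matrix (Fin 2) (Fin 2) ℂ)) (ψ q)) p v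
        + (1 / 4 : ℂ) • ∑ i : Fin 2, ∑ j : Fin 2,
          ((inner ℝ (covDeriv (fun q => rotVec (U q) (stdVec i.castSucc)) p v)
            (rotVec (U p) (stdVec j.castSucc)) : ℝ) : ℂ) •
          cliff (stdVec i.castSucc) (cliff (stdVec j.castSucc)
            (Matrix.toEuclideanLin (star (U p : Matrix (Fin 2) (Fin 2) ℂ)) (ψ p)))) := by
  classical
  let vv : tangent p := ⟨v, hv⟩
  let M : S2 → Matrix (Fin 2) (Fin 2) ℂ := fun q => (U q : Matrix (Fin 2) (Fin 2) ℂ)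
  have hM : DifferentiableAt ℝ (radialExt M) (p : E3) := by
    have h : radialExt M = fun x => ∑ i, ∑ j,
        radialExt (fun q => M q i j) x • Matrix.single i j (1 : ℂ) := by
      funext x
      by_cases hx : x ≠ 0
      · simp only [radialExt, dif_pos hx]
        conv_lhs => rw [Matrix.matrix_eq_sum_single (M _)]
        simp [Matrix.smul_single]
      · simp [radialExt, hx]
    rw [h]
    exact DifferentiableAt.fun_sum fun i _ => DifferentiableAt.fun_sum fun j _ =>
      (hd i j).smul_const _
  have hs1 : ∀ q, star (M q) * M q = 1 := fun q =>
    Matrix.mem_unitaryGroup_iff'.mp (Matrix.mem_specialUnitaryGroup_iff.mp (U q).2).1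
  have hs2 : ∀ q, M q * star (M q) = 1 := fun q =>
    Matrix.mem_unitaryGroup_iff.mp (Matrix.mem_specialUnitaryGroup_iff.mp (U q).2).1
  have hdet : ∀ q, (M q).det = 1 := fun q => (Matrix.mem_specialUnitaryGroup_iff.mp (U q).2).2
  have hMd := hasDerivAt_dirDeriv hM vv
  have hc0 : curve p vv 0 = p := curve_zero p vv
  set M' := dirDeriv M p vv with hM'
  set M0 := M p with hM0
  -- derivative of `U U* = 1`
  have F1 : M' * star M0 + M0 * star M' = 0 := by
    have h1 := hMd.mul hMd.star
    have h2 : HasDerivAt (fun _ : ℝ => (1 : Matrix (Fin 2) (Fin 2) ℂ)) 0 0 :=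
      hasDerivAt_const _ _
    have h3 := h1.unique (h2.congr_of_eventuallyEq
      (Filter.Eventually.of_forall fun t => by simpa using hs2 _))
    simpa [hc0] using h3
  -- derivative of `det U = 1`
  have F3 : (M' * star M0).trace = 0 := by
    have he : ∀ i j, HasDerivAt (fun t => M (curve p vv t) i j) (M' i j) 0 := by
      intro i j
      let k : Matrix (Fin 2) (Fin 2) ℂ →L[ℝ] ℂ := LinearMap.toContinuousLinearMap
        { toFun := fun X => X i j, map_add' := fun _ _ => rfl, map_smul' := fun _ _ => rfl }
      exact k.hasFDerivAt.comp_hasDerivAt (0 : ℝ) hMd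
    have h1 := ((he 0 0).mul (he 1 1)).sub ((he 0 1).mul (he 1 0))
    have h2 : HasDerivAt (fun _ : ℝ => (1 : ℂ)) 0 0 := hasDerivAt_const _ _
    have h3 := h1.unique (h2.congr_of_eventuallyEq
      (Filter.Eventually.of_forall fun t => by
        simpa [Matrix.det_fin_two] using hdet (curve p vv t)))
    simp only [hc0] at h3
    have h4 : star M0 = M0.adjugate := by
      have h5 : M0.adjugate * M0 = 1 := by rw [Matrix.adjugate_mul, hdet, one_smul]
      calc star M0 = (M0.adjugate * M0) * star M0 := by rw [h5, one_mul]
        _ = M0.adjugate := by rw [mul_assoc, hs2, mul_one]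
    rw [h4, Matrix.adjugate_fin_two]
    simp [Matrix.trace_fin_two, Matrix.mul_apply]
    linear_combination h3
  set A := M' * star M0 with hA
  have hMA : M' = A * M0 := by rw [hA, mul_assoc, hs1, mul_one]
  have hMA' : M0 * star M' = -A := by
    rw [eq_neg_iff_add_eq_zero, add_comm]; exact F1
  have hMA'' : star M' = -(star M0 * A) := by
    calc star M' = star M0 * (M0 * star M') := by rw [← mul_assoc, hs1, one_mul]
      _ = _ := by rw [hMA', mul_neg]
  -- derivative of the frame vectors
  have hconj : ∀ C : Matrix (Fin 2) (Fin 2) ℂ,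
      HasDerivAt (fun t => M (curve p vv t) * C * star (M (curve p vv t)))
        (A * (M0 * C * star M0) - (M0 * C * star M0) * A) 0 := by
    intro C
    have := (hMd.mul_const C).mul hMd.star
    have h2 : M' * C * star M0 + M0 * C * star M'
        = A * (M0 * C * star M0) - (M0 * C * star M0) * A := by
      rw [hMA'', hMA]; noncomm_ring
    simp only [hc0] at this
    rw [← h2]
    exact this
  have hP : pauli p = M0 * pauli (stdVec 2) * star M0 := by
    rw [← pauli_rotVec, hU.self_of_nhds]
  have hv' : pauli v = A * pauli p - pauli p * A := by
    have h1 : HasDerivAt (fun t => pauli (curve p vv t)) (pauli v) 0 :=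
      pauliL.hasFDerivAt.comp_hasDerivAt (0 : ℝ) (hasDerivAt_curve p vv)
    have hcont : Filter.Tendsto (curve p vv) (nhds 0) (nhds p) := by
      rw [nhds_subtype_eq_comap, Filter.tendsto_comap_iff]
      have := (hasDerivAt_curve p vv).continuousAt
      rw [ContinuousAt, hc0] at this
      exact this
    have h2 := (hconj (pauli (stdVec 2))).congr_of_eventuallyEq (f₁ := fun t =>
      pauli (curve p vv t)) (by
        filter_upwards [hcont.eventually hU] with t ht
        rw [← pauli_rotVec, ht])
    rw [hP]
    exact h1.unique h2
  have hpp : pauli p * pauli p = 1 := by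
    rw [hP]
    have : pauli (stdVec 2) * pauli (stdVec 2) = 1 := by
      ext i j; fin_cases i <;> fin_cases j <;> simp [pauli, stdVec]
    calc _ = M0 * pauli (stdVec 2) * (star M0 * M0) * pauli (stdVec 2) * star M0 := by
          noncomm_ring
      _ = M0 * (pauli (stdVec 2) * pauli (stdVec 2)) * star M0 := by
          rw [hs1]; noncomm_ring
      _ = 1 := by rw [this, mul_one, hs2]
  let s : Fin 3 → Matrix (Fin 2) (Fin 2) ℂ := fun i => M0 * pauli (stdVec i) * star M0
  have hss : ∀ i j, s i * s j = M0 * (pauli (stdVec i) * pauli (stdVec j)) * star M0 := by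
    intro i j
    calc _ = M0 * pauli (stdVec i) * (star M0 * M0) * pauli (stdVec j) * star M0 := by
          simp only [s]; noncomm_ring
      _ = _ := by rw [hs1]; noncomm_ring
  have hs01 : s 0 * s 1 = Complex.I • pauli p := by
    rw [hss, hP]
    have : pauli (stdVec 0) * pauli (stdVec 1) = Complex.I • pauli (stdVec 2) := by
      ext i j; fin_cases i <;> fin_cases j <;> simp [pauli, stdVec]
    rw [this]; simp
  have hs10 : s 1 * s 0 = -(Complex.I • pauli p) := by
    rw [hss, hP]
    have : pauli (stdVec 1) * pauli (stdVec 0) = -(Complex.I • pauli (stdVec 2)) := by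
      ext i j; fin_cases i <;> fin_cases j <;> simp [pauli, stdVec]
    rw [this]; simp
  have hw : ∀ i j : Fin 2,
      ((inner ℝ (covDeriv (fun q => rotVec (U q) (stdVec i.castSucc)) p v)
        (rotVec (U p) (stdVec j.castSucc)) : ℝ) : ℂ)
      = (1 / 2 : ℂ) * ((A * s i.castSucc - s i.castSucc * A) * s j.castSucc).trace := by
    intro i j
    have htan : rotVec (U p) (stdVec j.castSucc) ∈ tangent p := by
      refine Submodule.mem_orthogonal_singleton_iff_inner_right.mpr ?_
      have h := inner_eq_trace (p : E3) (rotVec (U p) (stdVec j.castSucc))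
      rw [pauli_rotVec, hP] at h
      have h2 : (s 2 * s j.castSucc).trace = 0 := by
        rw [hss, Matrix.trace_mul_comm, ← mul_assoc, hs1, one_mul]
        fin_cases j <;> simp [pauli, stdVec, Matrix.trace_fin_two]
      have h3 : ((inner ℝ (p : E3) (rotVec (U p) (stdVec j.castSucc)) : ℝ) : ℂ) = 0 := by
        rw [h]
        change (1 / 2 : ℂ) * (s 2 * s j.castSucc).trace = 0
        rw [h2, mul_zero]
      exact_mod_cast h3
    rw [covDeriv, Submodule.inner_starProjection_left_eq_right,
      Submodule.starProjection_eq_self_iff.mpr htan, inner_eq_trace, pauli_rotVec]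
    congr 3
    have hdiff : DifferentiableAt ℝ
        (radialExt fun q => rotVec (U q) (stdVec i.castSucc)) (p : E3) := by
      have h1 := radialExt_comp M
        (fun X => unpauliL (X * pauli (stdVec i.castSucc) * star X)) p
      refine DifferentiableAt.congr_of_eventuallyEq ?_ h1
      exact unpauliL.differentiableAt.comp _ ((hM.mul_const _).mul hM.star)
    have h1 := pauliL.hasFDerivAt.comp_hasDerivAt (0 : ℝ) (hasDerivAt_dirDeriv hdiff vv)
    refine h1.unique ((hconj (pauli (stdVec i.castSucc))).congr_of_eventuallyEq
      (Filter.Eventually.of_forall fun t => ?_))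
    exact pauli_rotVec _ _
  -- derivative of the local representative
  let b : Matrix (Fin 2) (Fin 2) ℂ →L[ℝ] Spinor →L[ℝ] Spinor := LinearMap.toContinuousLinearMap
    { toFun := fun X =>
        (LinearMap.toContinuousLinearMap (Matrix.toEuclideanLin X)).restrictScalars ℝ
      map_add' := fun X Y => by ext s : 1; simp
      map_smul' := fun c X => by
        ext s : 1
        change Matrix.toEuclideanLin (c • X) s = c • Matrix.toEuclideanLin X s
        have : c • X = (c : ℂ) • X := by ext; simp
        rw [this, map_smul]
        ext; simp }
  have hb : ∀ X s, b X s = Matrix.toEuclideanLin X s := fun _ _ => rfl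
  have F4 : dirDeriv (fun q => Matrix.toEuclideanLin (star (M q)) (ψ q)) p v
      = Matrix.toEuclideanLin (star M') (ψ p) + Matrix.toEuclideanLin (star M0) (dirDeriv ψ p v) := by
    have hdiff : DifferentiableAt ℝ
        (radialExt fun q => Matrix.toEuclideanLin (star (M q)) (ψ q)) (p : E3) := by
      have h1 := radialExt_comp (fun q => (M q, ψ q)) (fun X => b (star X.1) X.2) p
      refine DifferentiableAt.congr_of_eventuallyEq ?_ h1
      have e1 := radialExt_comp (fun q => (M q, ψ q)) (fun X => X.1) p
      have e2 := radialExt_comp (fun q => (M q, ψ q)) (fun X => X.2) p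
      have d1 := hM.congr_of_eventuallyEq e1.symm
      have d2 := hψ.congr_of_eventuallyEq e2.symm
      exact (b.differentiableAt.comp _ d1.star).clm_apply d2
    have h1 := (b.hasFDerivAt.comp_hasDerivAt (0 : ℝ) hMd.star).clm_apply
      (hasDerivAt_dirDeriv hψ vv)
    have h2 := (hasDerivAt_dirDeriv hdiff vv).unique h1
    simp only [Function.comp, hc0] at h2
    exact h2
  have F5 := traceless_anticomm F3 (B := pauli p) (by simp [pauli, Matrix.trace_fin_two])
  have F6 : A + pauli p * A * pauli p = (A * pauli p).trace • pauli p := by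
    calc A + pauli p * A * pauli p = A * (pauli p * pauli p) + pauli p * A * pauli p := by
          rw [hpp, mul_one]
      _ = (A * pauli p + pauli p * A) * pauli p := by noncomm_ring
      _ = _ := by rw [F5]; simp
  set τ := (A * pauli p).trace with hτ
  have w00 : ∀ i, ((A * s i - s i * A) * s i).trace = 0 := by
    intro i
    rw [sub_mul, Matrix.trace_sub, mul_assoc (s i), Matrix.trace_mul_comm (s i), sub_self]
  have w01 : ((A * s 0 - s 0 * A) * s 1).trace = 2 * Complex.I * τ := by
    rw [sub_mul, Matrix.trace_sub, mul_assoc (s 0), Matrix.trace_mul_comm (s 0),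
      mul_assoc A (s 0), mul_assoc A (s 1), hs01, hs10]
    simp [hτ]; ring
  have w10 : ((A * s 1 - s 1 * A) * s 0).trace = -(2 * Complex.I * τ) := by
    rw [sub_mul, Matrix.trace_sub, mul_assoc (s 1), Matrix.trace_mul_comm (s 1),
      mul_assoc A (s 1), mul_assoc A (s 0), hs01, hs10]
    simp [hτ]; ring
  have hcl : ∀ (i j : Fin 3) (x : Spinor), Matrix.toEuclideanLin M0 (cliff (stdVec i)
      (cliff (stdVec j) (Matrix.toEuclideanLin (star M0) x)))
      = -Matrix.toEuclideanLin (s i * s j) x := by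
    intro i j x
    rw [hss]
    simp only [cliff, LinearMap.smul_apply, map_smul, smul_smul, toLin_mul]
    simp
  have hcl2 : cliff v (cliff p (ψ p)) = -Matrix.toEuclideanLin (pauli v * pauli p) (ψ p) := by
    simp only [cliff, LinearMap.smul_apply, map_smul, smul_smul, toLin_mul]
    simp
  have hone : ∀ x : Spinor, Matrix.toEuclideanLin M0 (Matrix.toEuclideanLin (star M0) x) = x := by
    intro x
    rw [← toLin_mul, hs2]; simp
  change dirDeriv ψ p v + (1 / 2 : ℂ) • cliff v (cliff p (ψ p)) =
    Matrix.toEuclideanLin M0 (dirDeriv (fun q => Matrix.toEuclideanLin (star (M q)) (ψ q)) p v + _)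
  rw [F4, hcl2]
  simp only [hw, map_add, map_smul, map_sum, hone]
  rw [← toLin_mul, hMA']
  have hfin : ∀ i j : Fin 2, (Matrix.toEuclideanLin M0) ((cliff (stdVec i.castSucc))
      ((cliff (stdVec j.castSucc)) ((Matrix.toEuclideanLin (star M0)) (ψ p))))
      = -Matrix.toEuclideanLin (s i.castSucc * s j.castSucc) (ψ p) := fun i j => hcl _ _ _
  have key : -((1 / 2 : ℂ) • (pauli v * pauli p)) = -A + (1 / 2 : ℂ) • (τ • pauli p) := by
    rw [hv', ← F6, sub_mul, mul_assoc, hpp, mul_one]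
    module
  have hk := congrArg (fun X => Matrix.toEuclideanLin X (ψ p)) key
  simp only [map_neg, map_smul, map_add, LinearMap.neg_apply, LinearMap.smul_apply,
    LinearMap.add_apply] at hk
  have hsum : ∑ i : Fin 2, ∑ j : Fin 2,
      ((1 / 2 : ℂ) * ((A * s i.castSucc - s i.castSucc * A) * s j.castSucc).trace) •
        (Matrix.toEuclideanLin M0) ((cliff (stdVec i.castSucc))
          ((cliff (stdVec j.castSucc)) ((Matrix.toEuclideanLin (star M0)) (ψ p))))
      = (2 * τ) • Matrix.toEuclideanLin (pauli p) (ψ p) := by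
    simp only [hfin, Fin.sum_univ_two, Fin.castSucc_zero, Fin.castSucc_one, w00, w01, w10,
      hs01, hs10, map_neg, map_smul, LinearMap.neg_apply, LinearMap.smul_apply, smul_neg,
      smul_smul, neg_neg, mul_zero, zero_smul, neg_zero, zero_add, add_zero]
    rw [← neg_smul, ← add_smul]
    congr 1
    linear_combination (-2 * τ) * Complex.I_sq
  refine Eq.trans ?_ (congrArg (fun y => _ + (1 / 4 : ℂ) • y) hsum.symm)
  rw [smul_neg, hk, map_neg, LinearMap.neg_apply]
  module

end Local

/-! ### Strong chiral symmetry -/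

/-- The Kosmann-Lichnerowicz derivative along `X` has strong chiral symmetry. -/
structure HasStrongChiralSymmetry (X : S2 → E3) : Prop where
  /-- The matrix elements on the two chiralities agree on `V_{m>0}`. -/
  matrix_eq : ∀ φ ∈ positiveSpace, ∀ ψ ∈ positiveSpace,
    l2inner (plusPart φ) (kosmann X (plusPart ψ))
      = l2inner (minusPart φ) (kosmann X (minusPart ψ))
  /-- The kernel of the Dirac operator is preserved. -/
  kernel_mem : ∀ ψ ∈ eigenspace 0, kosmann X ψ ∈ eigenspace 0
  /-- There is a unitary equivariant map `V_0⁺ → V_0⁻` that intertwines the matrix elements. -/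
  kernel_iso : ∃ Θ : chiralKernel 1 ≃ₗ[ℂ] chiralKernel (-1),
    (∀ φ ψ : chiralKernel 1,
      l2inner (Θ φ : S2 → Spinor) (Θ ψ : S2 → Spinor) = l2inner (φ : S2 → Spinor) ψ) ∧
    (∀ (g : Matrix.specialUnitaryGroup (Fin 2) ℂ) (φ ψ : chiralKernel 1),
      (ψ : S2 → Spinor) = spinAct g φ →
        (Θ ψ : S2 → Spinor) = spinAct g (Θ φ : S2 → Spinor)) ∧
    (∀ φ ψ : chiralKernel 1,
      l2inner (φ : S2 → Spinor) (kosmann X ψ)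
        = l2inner (Θ φ : S2 → Spinor) (kosmann X (Θ ψ : S2 → Spinor)))

end SphereSpin

end

noncomputable section

namespace SphereSpin

open MeasureTheory
open scoped Pointwise

/-! ### Smooth functions on the sphere and their derivatives -/

section Calculus

variable {F : Type*} [NormedAddCommGroup F] [NormedSpace ℝ F]

/-! In the trivialization `S² × ℂ²` the Dirac operator is built from rotations. With `R_k` the
derivative along `p ↦ e_k × p` and `L_k = -i R_k`, one has `D = iΓK` with `K = 1 + σ·L`
(`dirac_eq`). Since `D` anticommutes with `Γ`, a spinor `b` with `K b = m b` gives `D(b + iΓb) = m(b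
+ iΓb)`. For a spherical harmonic `g` of degree `l` and a constant spinor `χ`, the spinor `b = (l +
1 + σ·L)(gχ)` satisfies `K b = (l + 1) b`, because `(σ·L)² = L² - σ·L`; for `g = 1` it is `χ`
itself, with `m = 1`.

The first condition of strong chiral symmetry is tested on `φ = b + iΓb` and `ψ = χ + iΓχ`. As `𝓛_X`
commutes with `Γ`, the positive and negative matrix elements are `⟨b, 𝓛_X χ⟩ ± ⟨b, Γ𝓛_X χ⟩`, so `⟨b,
Γ𝓛_X χ⟩ = 0`. Here `Γ𝓛_X χ = ½σ(X)χ + (i/4)(curl X)χ`. Summing over a basis of constant spinors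
takes a trace of Pauli matrices and leaves `∫ ((l + 1) g curl X + 2 ∑ X_k R_k g) = 0`. Integration
by parts gives `∫ g curl X = -∫ ∑ X_k R_k g`, hence `(1 - l) ∫ ∑ X_k R_k g = 0`
(`integral_eq_zero_of_hasStrongChiralSymmetry`).

Thus `X` is orthogonal to the rotated gradients `p × ∇g` of all harmonics of degree at least two;
the exceptional degree `l = 1` corresponds exactly to the rotation fields. That such a
divergence-free field is Killing (`isKilling_of_orthogonal`) is obtained without a Hodge
decomposition. Each Cartesian coordinate of `X` is shown to be orthogonal to the harmonics of degree
at least two, hence is affine. Tangency then makes the linear part skew.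

Being Killing is a closed condition on first derivatives, and adding a small multiple of a fixed
non-Killing field to a Killing field destroys it; this gives openness and density. -/

theorem norm_coe (p : S2) : ‖(p : E3)‖ = 1 := by simp

theorem coe_ne_zero (p : S2) : (p : E3) ≠ 0 := by
  intro h
  have := norm_coe p
  simp [h] at this

theorem sum_sq_coe (p : S2) : (p : E3) 0 ^ 2 + (p : E3) 1 ^ 2 + (p : E3) 2 ^ 2 = 1 := by
  have h := EuclideanSpace.norm_sq_eq (p : E3)
  rw [norm_coe] at h
  simpa [Fin.sum_univ_three] using h.symm

theorem mem_tangent_iff {p : S2} {v : E3} : v ∈ tangent p ↔ inner ℝ (p : E3) v = 0 :=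
  Submodule.mem_orthogonal_singleton_iff_inner_right

theorem mem_tangent_iff_coord {p : S2} {v : E3} :
    v ∈ tangent p ↔ (p : E3) 0 * v 0 + (p : E3) 1 * v 1 + (p : E3) 2 * v 2 = 0 := by
  rw [mem_tangent_iff]
  simp [PiLp.inner_apply, Fin.sum_univ_three, mul_comm]

theorem radialExt_coe {F : Type*} [Zero F] (f : S2 → F) (p : S2) : radialExt f (p : E3) = f p := by
  simp only [radialExt, dif_pos (coe_ne_zero p), norm_coe, inv_one, one_smul]

/-- The extension is `f` composed with the smooth map `x ↦ x/‖x‖`. Smoothness of all orders is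
needed for iterating rotational derivatives and for the `C^∞` topology. -/
theorem IsSmooth.contDiffAt_radialExt {f : S2 → F} (hf : IsSmooth f) {x : E3} (hx : x ≠ 0) :
    ContDiffAt ℝ ∞ (radialExt f) x := by
  let O : TopologicalSpace.Opens E3 := ⟨{0}ᶜ, isOpen_compl_singleton⟩
  have h1 : ContMDiff 𝓘(ℝ, E3) 𝓘(ℝ, E3) ∞ (fun x : O => ‖(x : E3)‖⁻¹ • (x : E3)) := by
    intro x
    have hx : (x : E3) ≠ 0 := x.2
    have : ContDiffAt ℝ ∞ (fun x : E3 => ‖x‖⁻¹ • x) (x : E3) :=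
      ((contDiffAt_norm ℝ hx).inv (norm_ne_zero_iff.mpr hx)).smul contDiffAt_id
    exact (this.contMDiffAt).comp x contMDiff_subtype_val.contMDiffAt
  have : Fact (Module.finrank ℝ E3 = 2 + 1) := ⟨by simp⟩
  have h2 := h1.codRestrict_sphere (n := 2) (fun x => normalize_mem x.2)
  have h3 : ContMDiffAt 𝓘(ℝ, E3) 𝓘(ℝ, F) ∞ (fun x : O => radialExt f x) ⟨x, hx⟩ := by
    have := (ContMDiff.comp hf h2).contMDiffAt (x := ⟨x, hx⟩)
    refine this.congr_of_eventuallyEq (Filter.Eventually.of_forall fun x => ?_)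
    have hx : (x : E3) ≠ 0 := x.2
    simp only [radialExt, dif_pos hx]
    rfl
  exact contMDiffAt_iff_contDiffAt.mp
    ((contMDiffAt_subtype_iff (x := (⟨x, hx⟩ : O))).mp h3)

theorem _root_.ContDiff.isSmooth_restrict {f : E3 → F} (hf : ContDiff ℝ ∞ f) :
    IsSmooth (fun p : S2 => f p) := by
  have : Fact (Module.finrank ℝ E3 = 2 + 1) := ⟨by simp⟩
  exact hf.contMDiff.comp contMDiff_coe_sphere

theorem _root_.ContDiff.comp_isSmooth {G : Type*} [NormedAddCommGroup G] [NormedSpace ℝ G]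
    {k : F → G} (hk : ContDiff ℝ ∞ k) {f : S2 → F} (hf : IsSmooth f) :
    IsSmooth (fun p => k (f p)) :=
  hk.contMDiff.comp hf

theorem IsSmooth.continuous {f : S2 → F} (hf : IsSmooth f) : Continuous f :=
  ContMDiff.continuous hf

theorem isSmooth_coe : IsSmooth (fun p : S2 => (p : E3)) := contDiff_id.isSmooth_restrict

theorem isSmooth_of_restrict {f : S2 → F} {g : E3 → F} (hg : ∀ p : S2, ContDiffAt ℝ ∞ g p)
    (h : ∀ p : S2, f p = g p) : IsSmooth f := by
  have : Fact (Module.finrank ℝ E3 = 2 + 1) := ⟨by simp⟩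
  intro p
  have h1 : ContMDiffAt (𝓡 2) 𝓘(ℝ, F) ∞ (g ∘ ((↑) : S2 → E3)) p :=
    (hg p).contMDiffAt.comp p contMDiff_coe_sphere.contMDiffAt
  have h2 : f = g ∘ ((↑) : S2 → E3) := funext h
  rw [h2]
  exact h1

theorem isSmooth_const (c : F) : IsSmooth (fun _ : S2 => c) := contMDiff_const

theorem IsSmooth.prodMk {G : Type*} [NormedAddCommGroup G] [NormedSpace ℝ G]
    {f : S2 → F} {g : S2 → G} (hf : IsSmooth f) (hg : IsSmooth g) :
    IsSmooth (fun p => (f p, g p)) :=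
  ContMDiff.prodMk_space hf hg

/-- A derivative along the curve computes the directional derivative. -/
theorem IsSmooth.dirDeriv_eq {f : S2 → F} (hf : IsSmooth f) {p : S2} {v : E3} (hv : v ∈ tangent p)
    {f' : F} (h : HasDerivAt (fun t => f (curve p ⟨v, hv⟩ t)) f' 0) : dirDeriv f p v = f' :=
  (hasDerivAt_dirDeriv (hf.differentiableAt_radialExt p) ⟨v, hv⟩).unique h

theorem IsSmooth.hasDerivAt_curve {f : S2 → F} (hf : IsSmooth f) {p : S2} {v : E3}
    (hv : v ∈ tangent p) : HasDerivAt (fun t => f (curve p ⟨v, hv⟩ t)) (dirDeriv f p v) 0 :=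
  hasDerivAt_dirDeriv (hf.differentiableAt_radialExt p) ⟨v, hv⟩

theorem dirDeriv_restrict {f : E3 → F} (hf : ContDiff ℝ ∞ f) {p : S2} {v : E3}
    (hv : v ∈ tangent p) : dirDeriv (fun q : S2 => f q) p v = fderiv ℝ f p v := by
  refine hf.isSmooth_restrict.dirDeriv_eq hv ?_
  have h1 : HasFDerivAt f (fderiv ℝ f p) (curve p ⟨v, hv⟩ 0 : E3) := by
    rw [curve_zero]
    exact (hf.differentiable (by simp) _).hasFDerivAt
  exact h1.comp_hasDerivAt (0 : ℝ) (SphereSpin.hasDerivAt_curve p ⟨v, hv⟩)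

theorem dirDeriv_clm_comp {G : Type*} [NormedAddCommGroup G] [NormedSpace ℝ G] (k : F →L[ℝ] G)
    {f : S2 → F} (hf : IsSmooth f) {p : S2} {v : E3} (hv : v ∈ tangent p) :
    dirDeriv (fun q => k (f q)) p v = k (dirDeriv f p v) :=
  (k.contDiff.comp_isSmooth hf).dirDeriv_eq hv
    (k.hasFDerivAt.comp_hasDerivAt (0 : ℝ) (hf.hasDerivAt_curve hv))

theorem dirDeriv_coe {p : S2} {v : E3} (hv : v ∈ tangent p) :
    dirDeriv (fun q : S2 => (q : E3)) p v = v := by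
  simpa using dirDeriv_restrict (f := fun x => x) contDiff_id hv

theorem dirDeriv_const (c : F) {p : S2} {v : E3} (hv : v ∈ tangent p) :
    dirDeriv (fun _ : S2 => c) p v = 0 :=
  (isSmooth_const c).dirDeriv_eq hv (hasDerivAt_const _ _)

theorem IsSmooth.mul {f g : S2 → ℝ} (hf : IsSmooth f) (hg : IsSmooth g) :
    IsSmooth (fun p => f p * g p) :=
  (contDiff_fst.mul contDiff_snd).comp_isSmooth (hf.prodMk hg)

theorem dirDeriv_mul {f g : S2 → ℝ} (hf : IsSmooth f) (hg : IsSmooth g) {p : S2} {v : E3}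
    (hv : v ∈ tangent p) :
    dirDeriv (fun q => f q * g q) p v = dirDeriv f p v * g p + f p * dirDeriv g p v := by
  refine (hf.mul hg).dirDeriv_eq hv ?_
  simpa only [curve_zero] using (hf.hasDerivAt_curve hv).fun_mul (hg.hasDerivAt_curve hv)

theorem dirDeriv_smul_vec (p : S2) (f : S2 → F) (c : ℝ) (v : E3) :
    dirDeriv f p (c • v) = c • dirDeriv f p v := map_smul _ _ _

theorem dirDeriv_add_vec (p : S2) (f : S2 → F) (u v : E3) :
    dirDeriv f p (u + v) = dirDeriv f p u + dirDeriv f p v := map_add _ _ _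

/-- The extension is constant along rays. -/
theorem IsSmooth.dirDeriv_self {f : S2 → F} (hf : IsSmooth f) (p : S2) : dirDeriv f p p = 0 := by
  have h1 : HasDerivAt (fun t : ℝ => (p : E3) + t • (p : E3)) (p : E3) 0 := by
    simpa using ((hasDerivAt_id (0 : ℝ)).smul_const (p : E3)).const_add (p : E3)
  have h2 : HasFDerivAt (radialExt f) (fderiv ℝ (radialExt f) (p : E3))
      ((p : E3) + (0 : ℝ) • (p : E3)) := by
    simpa using (hf.differentiableAt_radialExt p).hasFDerivAt
  have h3 := h2.comp_hasDerivAt (0 : ℝ) h1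
  refine h3.unique ((hasDerivAt_const (0 : ℝ) (f p)).congr_of_eventuallyEq ?_)
  -- For `t > -1` the point `p + tp` is still on the ray through `p`.
  filter_upwards [isOpen_Ioi.mem_nhds (show (-1 : ℝ) < 0 by norm_num)] with t ht
  have ht : 0 < 1 + t := by linarith [Set.mem_Ioi.mp ht]
  have h4 : (p : E3) + t • (p : E3) = (1 + t) • (p : E3) := by rw [add_smul, one_smul]
  have h5 : (1 + t) • (p : E3) ≠ 0 := smul_ne_zero ht.ne' (coe_ne_zero p)
  simp only [Function.comp, h4, radialExt, dif_pos h5]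
  congr 1
  apply Subtype.ext
  simp [norm_smul, abs_of_pos ht, smul_smul, ht.ne']

end Calculus

/-! ### Rotational derivatives -/

/-- The cross product on Euclidean three-space. -/
def cross (u v : E3) : E3 :=
  !₂[u 1 * v 2 - u 2 * v 1, u 2 * v 0 - u 0 * v 2, u 0 * v 1 - u 1 * v 0]

@[simp] theorem cross_zero_apply (u v : E3) : cross u v 0 = u 1 * v 2 - u 2 * v 1 := rfl
@[simp] theorem cross_one_apply (u v : E3) : cross u v 1 = u 2 * v 0 - u 0 * v 2 := rfl
@[simp] theorem cross_two_apply (u v : E3) : cross u v 2 = u 0 * v 1 - u 1 * v 0 := rfl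

theorem inner_eq_coord (u v : E3) : inner ℝ u v = u 0 * v 0 + u 1 * v 1 + u 2 * v 2 := by
  simp [PiLp.inner_apply, Fin.sum_univ_three, mul_comm]

theorem cross_mem_tangent (w : E3) (p : S2) : cross w p ∈ tangent p := by
  rw [mem_tangent_iff_coord]; simp; ring

/-- The linear map `w × ·`. -/
def crossL (w : E3) : E3 →L[ℝ] E3 :=
  LinearMap.toContinuousLinearMap
    { toFun := cross w
      map_add' := fun x y => by ext i; fin_cases i <;> simp <;> ring
      map_smul' := fun c x => by ext i; fin_cases i <;> simp <;> ring }

@[simp] theorem crossL_apply (w x : E3) : crossL w x = cross w x := rfl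

theorem crossL_mem_skewAdjoint (w : E3) : crossL w ∈ skewAdjoint (E3 →L[ℝ] E3) := by
  rw [skewAdjoint.mem_iff, ContinuousLinearMap.star_eq_adjoint, eq_comm]
  rw [ContinuousLinearMap.eq_adjoint_iff]
  intro x y
  simp only [_root_.neg_apply, crossL_apply, inner_neg_left, inner_eq_coord,
    cross_zero_apply, cross_one_apply, cross_two_apply]
  ring

theorem exp_crossL_mem_unitary (w : E3) (t : ℝ) :
    NormedSpace.exp (t • crossL w) ∈ unitary (E3 →L[ℝ] E3) := by
  let _ : NormedAlgebra ℚ (E3 →L[ℝ] E3) := NormedAlgebra.restrictScalars ℚ ℝ _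
  exact NormedSpace.exp_mem_unitary_of_mem_skewAdjoint
    (skewAdjoint.smul_mem t (crossL_mem_skewAdjoint w))

/-- The rotation by the angle `t |w|` around the axis `w`. -/
def rotL (w : E3) (t : ℝ) : E3 ≃ₗᵢ[ℝ] E3 :=
  Unitary.linearIsometryEquiv ⟨NormedSpace.exp (t • crossL w), exp_crossL_mem_unitary w t⟩

theorem rotL_apply (w : E3) (t : ℝ) (x : E3) : rotL w t x = NormedSpace.exp (t • crossL w) x := rfl

theorem rotL_zero (w x : E3) : rotL w 0 x = x := by
  have h : (0 : ℝ) • crossL w = 0 := by ext x i; simp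
  rw [rotL_apply, h, NormedSpace.exp_zero]; rfl

theorem hasDerivAt_rotL (w x : E3) (t : ℝ) :
    HasDerivAt (fun t => rotL w t x) (cross w (rotL w t x)) t := by
  have h := (hasDerivAt_exp_smul_const' (𝕂 := ℝ) (crossL w) t).clm_apply (hasDerivAt_const t x)
  simp only [map_zero, add_zero] at h
  exact h

/-- A linear isometry acts on the sphere. -/
def isomS2 (U : E3 ≃ₗᵢ[ℝ] E3) (p : S2) : S2 := ⟨U p, by simp⟩

@[simp] theorem coe_isomS2 (U : E3 ≃ₗᵢ[ℝ] E3) (p : S2) : (isomS2 U p : E3) = U p := rfl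

theorem continuous_isomS2 (U : E3 ≃ₗᵢ[ℝ] E3) : Continuous (isomS2 U) :=
  (U.continuous.comp continuous_subtype_val).subtype_mk _

/-- The area measure of the sphere. -/
abbrev area : Measure S2 := (volume : Measure E3).toSphere

/-- The area of `s` is a multiple of the volume of the cone over `s`; a linear isometry preserves
volume and carries cones to cones. -/
theorem measurePreserving_isomS2 (U : E3 ≃ₗᵢ[ℝ] E3) : MeasurePreserving (isomS2 U) area area := by
  refine ⟨(continuous_isomS2 U).measurable, ?_⟩
  ext s hs
  rw [Measure.map_apply (continuous_isomS2 U).measurable hs, Measure.toSphere_apply' _ hs,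
    Measure.toSphere_apply' _ ((continuous_isomS2 U).measurable hs)]
  congr 1
  have h : Set.Ioo (0 : ℝ) 1 • (((↑) : S2 → E3) '' (isomS2 U ⁻¹' s))
      = U ⁻¹' (Set.Ioo (0 : ℝ) 1 • (((↑) : S2 → E3) '' s)) := by
    ext x
    simp only [Set.mem_smul, Set.mem_image, Set.mem_preimage]
    constructor
    · rintro ⟨r, hr, _, ⟨p, hp, rfl⟩, rfl⟩
      exact ⟨r, hr, _, ⟨_, hp, rfl⟩, by simp⟩
    · rintro ⟨r, hr, _, ⟨p, hp, rfl⟩, h⟩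
      refine ⟨r, hr, _, ⟨isomS2 U.symm p, ?_, rfl⟩, ?_⟩
      · have : isomS2 U (isomS2 U.symm p) = p := Subtype.ext (by simp)
        simpa [this] using hp
      · apply U.injective
        simp [← h]
  rw [h]
  exact MeasurePreserving.measure_preimage_equiv (f := U.toMeasurableEquiv) U.measurePreserving _

theorem _root_.Continuous.integrable_area {F : Type*} [NormedAddCommGroup F] {f : S2 → F}
    (hf : Continuous f) : Integrable f area :=
  hf.integrable_of_hasCompactSupport (HasCompactSupport.of_compactSpace f)

/-- The derivative of `f` along the field `p ↦ w × p`. -/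
def angDeriv {F : Type*} [NormedAddCommGroup F] [NormedSpace ℝ F] (w : E3) (f : S2 → F)
    (p : S2) : F :=
  dirDeriv f p (cross w p)

theorem IsSmooth.angDeriv {F : Type*} [NormedAddCommGroup F] [NormedSpace ℝ F] {f : S2 → F}
    (hf : IsSmooth f) (w : E3) : IsSmooth (angDeriv w f) := by
  refine isSmooth_of_restrict (g := fun x => fderiv ℝ (radialExt f) x (crossL w x))
    (fun p => ?_) (fun p => rfl)
  exact ((hf.contDiffAt_radialExt (coe_ne_zero p)).fderiv_right (m := ∞) (by simp)).clm_apply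
    (crossL w).contDiff.contDiffAt

/-- By rotation invariance of the area, the integral of `f` composed with the rotation by `t` is
constant in `t`; its derivative at `0` is the integral in question. -/
theorem integral_angDeriv (w : E3) {f : S2 → ℝ} (hf : IsSmooth f) :
    ∫ p, angDeriv w f p ∂area = 0 := by
  obtain ⟨C, hC⟩ := (isCompact_range (hf.angDeriv w).continuous).isBounded.exists_norm_le
  have hd : ∀ (p : S2) (t : ℝ), HasDerivAt (fun t => f (isomS2 (rotL w t) p))
      (angDeriv w f (isomS2 (rotL w t) p)) t := by
    intro p t
    have h := ((hf.differentiableAt_radialExt (isomS2 (rotL w t) p)).hasFDerivAt).comp_hasDerivAt t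
      (hasDerivAt_rotL w (p : E3) t)
    refine h.congr_of_eventuallyEq (Filter.Eventually.of_forall fun s => ?_)
    exact (radialExt_coe f (isomS2 (rotL w s) p)).symm
  have h := hasDerivAt_integral_of_dominated_loc_of_deriv_le (μ := area) (𝕜 := ℝ)
    (F := fun t p => f (isomS2 (rotL w t) p))
    (F' := fun t p => angDeriv w f (isomS2 (rotL w t) p)) (x₀ := 0) (s := Set.univ)
    (bound := fun _ => C) Filter.univ_mem
    (Filter.Eventually.of_forall fun t =>
      (hf.continuous.comp (continuous_isomS2 _)).aestronglyMeasurable)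
    ((hf.continuous.comp (continuous_isomS2 _)).integrable_area)
    (((hf.angDeriv w).continuous.comp (continuous_isomS2 _)).aestronglyMeasurable)
    (Filter.Eventually.of_forall fun p t _ => hC _ (Set.mem_range_self _))
    (integrable_const C)
    (Filter.Eventually.of_forall fun p t _ => hd p t)
  have hinv : ∀ t, ∫ p, f (isomS2 (rotL w t) p) ∂area = ∫ p, f p ∂area := by
    intro t
    have hm := (measurePreserving_isomS2 (rotL w t)).map_eq
    conv_rhs => rw [← hm]
    rw [integral_map (continuous_isomS2 _).aemeasurable hf.continuous.aestronglyMeasurable]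
  have h0 : ∀ p : S2, isomS2 (rotL w 0) p = p := fun p => Subtype.ext (rotL_zero w p)
  have h2 := h.2
  simp only [hinv, h0] at h2
  exact h2.unique (hasDerivAt_const _ _)

/-- Integration by parts, from the product rule: rotational derivatives are skew for the `L²`
product. -/
theorem integral_mul_angDeriv (w : E3) {f g : S2 → ℝ} (hf : IsSmooth f) (hg : IsSmooth g) :
    ∫ p, f p * angDeriv w g p ∂area = -∫ p, angDeriv w f p * g p ∂area := by
  have h := integral_angDeriv w (hf.mul hg)
  have h1 : ∀ p, angDeriv w (fun q => f q * g q) p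
      = angDeriv w f p * g p + f p * angDeriv w g p :=
    fun p => dirDeriv_mul hf hg (cross_mem_tangent w p)
  simp only [h1] at h
  rw [integral_add ((hf.angDeriv w).mul hg).continuous.integrable_area
    (hf.mul (hg.angDeriv w)).continuous.integrable_area] at h
  linarith

/-! ### Polynomials on the sphere -/

section Polynomials

open MvPolynomial

/-- Real polynomials in three variables. -/
abbrev Poly : Type := MvPolynomial (Fin 3) ℝ

/-- The restriction of a polynomial to the sphere. -/
def evalS (q : Poly) (p : S2) : ℝ := eval (fun i => (p : E3) i) q

/-- The commutator of two derivations is a derivation, so it is enough to check it on the variables.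
-/
theorem pderiv_comm (i j : Fin 3) (q : Poly) : pderiv i (pderiv j q) = pderiv j (pderiv i q) := by
  have h : ⁅pderiv (R := ℝ) i, pderiv (R := ℝ) j⁆ = 0 := by
    refine MvPolynomial.derivation_ext fun k => ?_
    rw [Derivation.commutator_apply, pderiv_X, pderiv_X]
    simp [Pi.single_apply, apply_ite]
  have h2 := DFunLike.congr_fun h q
  rw [Derivation.commutator_apply] at h2
  exact sub_eq_zero.mp h2

theorem hasFDerivAt_eval (q : Poly) (x : E3) :
    HasFDerivAt (fun x : E3 => eval (fun i => x i) q)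
      (∑ i, eval (fun i => x i) (pderiv i q) • (EuclideanSpace.proj i : E3 →L[ℝ] ℝ)) x := by
  induction q using MvPolynomial.induction_on with
  | C a => simpa using hasFDerivAt_const a x
  | add q r hq hr =>
    simp only [map_add, add_smul, Finset.sum_add_distrib]
    exact hq.add hr
  | mul_X q j hq =>
    have h1 : HasFDerivAt (fun x : E3 => x j) (EuclideanSpace.proj j : E3 →L[ℝ] ℝ) x :=
      (EuclideanSpace.proj j : E3 →L[ℝ] ℝ).hasFDerivAt
    have h2 := hq.mul h1
    simp only [map_mul, eval_X]
    refine h2.congr_fderiv ?_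
    ext v
    fin_cases j <;> simp [Fin.sum_univ_three, pderiv_X, Pi.single_apply] <;> ring

theorem contDiff_eval (q : Poly) : ContDiff ℝ ∞ (fun x : E3 => eval (fun i => x i) q) := by
  induction q using MvPolynomial.induction_on with
  | C a => simpa using contDiff_const
  | add q r hq hr => simpa using hq.add hr
  | mul_X q j hq =>
    simpa using hq.mul (EuclideanSpace.proj j : E3 →L[ℝ] ℝ).contDiff

theorem isSmooth_evalS (q : Poly) : IsSmooth (evalS q) := (contDiff_eval q).isSmooth_restrict

theorem dirDeriv_evalS (q : Poly) {p : S2} {v : E3} (hv : v ∈ tangent p) :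
    dirDeriv (evalS q) p v = evalS (pderiv 0 q) p * v 0 + evalS (pderiv 1 q) p * v 1
      + evalS (pderiv 2 q) p * v 2 := by
  have h := dirDeriv_restrict (contDiff_eval q) hv
  rw [(hasFDerivAt_eval q p).fderiv] at h
  exact h.trans (by simp [Fin.sum_univ_three, evalS])

/-- The rotational derivative of polynomials around a coordinate axis. -/
def rotP (k : Fin 3) : Derivation ℝ Poly Poly :=
  (X (k + 1) : Poly) • pderiv (k + 2) - (X (k + 2) : Poly) • pderiv (k + 1)

theorem rotP_zero (q : Poly) : rotP 0 q = X 1 * pderiv 2 q - X 2 * pderiv 1 q := rfl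
theorem rotP_one (q : Poly) : rotP 1 q = X 2 * pderiv 0 q - X 0 * pderiv 2 q := rfl
theorem rotP_two (q : Poly) : rotP 2 q = X 0 * pderiv 1 q - X 1 * pderiv 0 q := rfl

theorem angDeriv_evalS (k : Fin 3) (q : Poly) :
    angDeriv (stdVec k) (evalS q) = evalS (rotP k q) := by
  funext p
  rw [angDeriv, dirDeriv_evalS q (cross_mem_tangent _ p)]
  fin_cases k <;> simp [stdVec, evalS, rotP_zero, rotP_one, rotP_two] <;> ring

/-- The sum of the squares of the rotational derivatives. -/
def lapS : Poly →ₗ[ℝ] Poly :=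
  ∑ k, (rotP k : Poly →ₗ[ℝ] Poly) ∘ₗ (rotP k : Poly →ₗ[ℝ] Poly)

theorem lapS_apply (q : Poly) :
    lapS q = rotP 0 (rotP 0 q) + rotP 1 (rotP 1 q) + rotP 2 (rotP 2 q) := by
  simp [lapS, Fin.sum_univ_three]

/-- The Euclidean Laplacian. -/
def lap (q : Poly) : Poly :=
  pderiv 0 (pderiv 0 q) + pderiv 1 (pderiv 1 q) + pderiv 2 (pderiv 2 q)

/-- The squared radius. -/
def r2 : Poly := X 0 ^ 2 + X 1 ^ 2 + X 2 ^ 2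

theorem rotP_comm_zero_one (q : Poly) : rotP 0 (rotP 1 q) - rotP 1 (rotP 0 q) = -rotP 2 q := by
  simp only [rotP_zero, rotP_one, rotP_two, map_sub, pderiv_mul, pderiv_X, Pi.single_apply,
    pderiv_comm 1 0, pderiv_comm 2 0, pderiv_comm 2 1]
  simp
  ring

theorem rotP_comm_one_two (q : Poly) : rotP 1 (rotP 2 q) - rotP 2 (rotP 1 q) = -rotP 0 q := by
  simp only [rotP_zero, rotP_one, rotP_two, map_sub, pderiv_mul, pderiv_X, Pi.single_apply,
    pderiv_comm 1 0, pderiv_comm 2 0, pderiv_comm 2 1]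
  simp
  ring

theorem rotP_comm_two_zero (q : Poly) : rotP 2 (rotP 0 q) - rotP 0 (rotP 2 q) = -rotP 1 q := by
  simp only [rotP_zero, rotP_one, rotP_two, map_sub, pderiv_mul, pderiv_X, Pi.single_apply,
    pderiv_comm 1 0, pderiv_comm 2 0, pderiv_comm 2 1]
  simp
  ring

/-- The Casimir element commutes with the Lie algebra; this keeps rotational derivatives of a
harmonic polynomial harmonic of the same degree. -/
theorem lapS_rotP (k : Fin 3) (q : Poly) : lapS (rotP k q) = rotP k (lapS q) := by
  have a := rotP_comm_zero_one
  have b := rotP_comm_one_two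
  have c := rotP_comm_two_zero
  simp only [lapS_apply, map_add]
  fin_cases k
  · have h1 := congrArg (rotP 1) (a q)
    have h2 := congrArg (rotP 2) (c q)
    simp only [map_sub, map_neg] at h1 h2
    simp only [Fin.zero_eta]
    linear_combination -h1 + h2 - a (rotP 1 q) + c (rotP 2 q)
  · have h1 := congrArg (rotP 0) (a q)
    have h2 := congrArg (rotP 2) (b q)
    simp only [map_sub, map_neg] at h1 h2
    simp only [Fin.mk_one]
    linear_combination h1 - h2 + a (rotP 0 q) - b (rotP 2 q)
  · have h1 := congrArg (rotP 1) (b q)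
    have h2 := congrArg (rotP 0) (c q)
    simp only [map_sub, map_neg] at h1 h2
    simp only [Fin.reduceFinMk]
    linear_combination h1 - h2 + b (rotP 1 q) - c (rotP 0 q)

theorem rotP_r2 (k : Fin 3) : rotP k r2 = 0 := by
  fin_cases k <;>
    simp [rotP_zero, rotP_one, rotP_two, r2, pderiv_X] <;> ring

theorem rotP_r2_pow_mul (k : Fin 3) (m : ℕ) (q : Poly) :
    rotP k (r2 ^ m * q) = r2 ^ m * rotP k q := by
  rw [Derivation.leibniz, Derivation.leibniz_pow, rotP_r2]
  simp

theorem lapS_r2_pow_mul (m : ℕ) (q : Poly) : lapS (r2 ^ m * q) = r2 ^ m * lapS q := by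
  simp only [lapS_apply, rotP_r2_pow_mul]
  ring

theorem evalS_r2 (p : S2) : evalS r2 p = 1 := by
  simp [evalS, r2, sum_sq_coe]

/-! ### Homogeneous polynomials and their decomposition into spherical harmonics -/

theorem isHomogeneous_r2 : r2.IsHomogeneous 2 :=
  ((isHomogeneous_X_pow 0 2).add (isHomogeneous_X_pow 1 2)).add (isHomogeneous_X_pow 2 2)

theorem isHomogeneous_rotP {q : Poly} {l : ℕ} (h : q.IsHomogeneous l) (k : Fin 3) :
    (rotP k q).IsHomogeneous l := by
  rcases Nat.eq_zero_or_pos l with rfl | hl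
  · have h2 : rotP k q = 0 := by
      rw [← totalDegree_zero_iff_isHomogeneous, totalDegree_eq_zero_iff_eq_C] at h
      rw [h]
      exact (rotP k).map_algebraMap _
    rw [h2]
    exact isHomogeneous_zero _ _ _
  · have h1 : ∀ i j, (X i * pderiv j q : Poly).IsHomogeneous l := fun i j => by
      have := (isHomogeneous_X ℝ i).mul (h.pderiv (i := j))
      rwa [Nat.add_sub_cancel' hl] at this
    exact (h1 _ _).sub (h1 _ _)

theorem isHomogeneous_lap {q : Poly} {l : ℕ} (h : q.IsHomogeneous l) :
    (lap q).IsHomogeneous (l - 2) := by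
  have h1 : ∀ i : Fin 3, (pderiv i (pderiv i q)).IsHomogeneous (l - 2) :=
    fun i => h.pderiv.pderiv
  exact ((h1 0).add (h1 1)).add (h1 2)

theorem euler {q : Poly} {l : ℕ} (h : q.IsHomogeneous l) :
    X 0 * pderiv 0 q + X 1 * pderiv 1 q + X 2 * pderiv 2 q = (l : Poly) * q := by
  have := h.sum_X_mul_pderiv
  simpa [Fin.sum_univ_three] using this

/-- This is the polar decomposition `r²Δ = ∑ R_k² + E(E + 1)`, where the Euler operator `E` acts as
`l` in degree `l`. -/
theorem lapS_eq_of_isHomogeneous {q : Poly} {l : ℕ} (h : q.IsHomogeneous l) :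
    lapS q = r2 * lap q - (l : Poly) * (l + 1) * q := by
  have h0 := euler h
  -- Differentiating the Euler identity once more handles the second-order terms `x_i x_j ∂_i ∂_j`.
  have d : ∀ i : Fin 3, pderiv i (X 0 * pderiv 0 q + X 1 * pderiv 1 q + X 2 * pderiv 2 q)
      = (l : Poly) * pderiv i q := fun i => by
    rw [h0, show (l : Poly) = C (l : ℝ) by simp, pderiv_C_mul]
  have d0 := d 0
  have d1 := d 1
  have d2 := d 2
  simp only [map_add, pderiv_mul, pderiv_X, Pi.single_apply, pderiv_comm 1 0, pderiv_comm 2 0,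
    pderiv_comm 2 1] at d0 d1 d2
  simp at d0 d1 d2
  simp only [lapS_apply, rotP_zero, rotP_one, rotP_two, map_sub, pderiv_mul, pderiv_X,
    Pi.single_apply, pderiv_comm 1 0, pderiv_comm 2 0, pderiv_comm 2 1, r2, lap]
  simp
  linear_combination -X 0 * d0 - X 1 * d1 - X 2 * d2 - ((l : Poly) + 1) * h0

/-- Homogeneous polynomials of degree `l` that restrict to spherical harmonics. -/
def IsHarm (l : ℕ) (h : Poly) : Prop :=
  h.IsHomogeneous l ∧ lapS h = -((l : ℝ) * (l + 1)) • h

theorem IsHarm.rotP {l : ℕ} {h : Poly} (hh : IsHarm l h) (k : Fin 3) : IsHarm l (rotP k h) :=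
  ⟨isHomogeneous_rotP hh.1 k, by rw [lapS_rotP, hh.2, Derivation.map_smul]⟩

/-- Polynomials that are homogeneous of degree `k` decompose into harmonic ones. -/
theorem mem_span_harm (k : ℕ) : ∀ q : Poly, q.IsHomogeneous k →
    q ∈ Submodule.span ℝ {f | ∃ m j h, 2 * m + j = k ∧ IsHarm j h ∧ f = r2 ^ m * h} := by
  induction k using Nat.strong_induction_on with
  | _ k ih =>
  intro q hq
  by_cases hk : k < 2
  · have h1 : lap q = 0 := by
      have h2 : ∀ i : Fin 3, pderiv i (pderiv i q) = 0 := fun i => by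
        have h3 : (pderiv i q).IsHomogeneous 0 := by
          have := hq.pderiv (i := i)
          rwa [show k - 1 = 0 by omega] at this
        rw [← totalDegree_zero_iff_isHomogeneous, totalDegree_eq_zero_iff_eq_C] at h3
        rw [h3, pderiv_C]
      simp [lap, h2]
    refine Submodule.subset_span ⟨0, k, q, by simp, ⟨hq, ?_⟩, by simp⟩
    rw [lapS_eq_of_isHomogeneous hq, h1, MvPolynomial.smul_eq_C_mul]
    simp
  -- Induction applies to `f = lap q`. Solving `(lapS + k(k + 1)) s = r² f` inside the span makes `q
  -- - s` an eigenvector of `lapS` with eigenvalue `-k(k + 1)`, that is, harmonic.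
  · have key : ∀ f ∈ Submodule.span ℝ
        {f | ∃ m j h, 2 * m + j = k - 2 ∧ IsHarm j h ∧ f = r2 ^ m * h},
        ∃ s ∈ Submodule.span ℝ {f | ∃ m j h, 2 * m + j = k ∧ IsHarm j h ∧ f = r2 ^ m * h},
          s.IsHomogeneous k ∧ lapS s + ((k : ℝ) * (k + 1)) • s = r2 * f := by
      intro f hf
      induction hf using Submodule.span_induction with
      | mem f hf =>
        obtain ⟨m, j, h, hm, hh, rfl⟩ := hf
        have hjk : (j : ℝ) < k := by
          have : j < k := by omega
          exact_mod_cast this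
        have hj0 : (0 : ℝ) ≤ j := Nat.cast_nonneg j
        -- The factor by which `lapS + k(k + 1)` acts on `r^(2m+2) h` with `h` harmonic of degree
        -- `j`; it is nonzero because `j < k`.
        have hc : (k : ℝ) * (k + 1) - j * (j + 1) ≠ 0 := by nlinarith
        refine ⟨((k : ℝ) * (k + 1) - j * (j + 1))⁻¹ • (r2 ^ (m + 1) * h),
          Submodule.smul_mem _ _ (Submodule.subset_span ⟨m + 1, j, h, by omega, hh, rfl⟩), ?_, ?_⟩
        · rw [MvPolynomial.smul_eq_C_mul]
          refine IsHomogeneous.C_mul ?_ _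
          have := (isHomogeneous_r2.pow (m + 1)).mul hh.1
          rwa [show 2 * (m + 1) + j = k by omega] at this
        · rw [map_smul, lapS_r2_pow_mul, hh.2, mul_smul_comm]
          have : r2 * (r2 ^ m * h) = r2 ^ (m + 1) * h := by ring
          rw [this]
          match_scalars
          field_simp
          ring
      | zero => exact ⟨0, zero_mem _, isHomogeneous_zero _ _ _, by simp⟩
      | add f g _ _ hf hg =>
        obtain ⟨s, hs, hs1, hs2⟩ := hf
        obtain ⟨t, ht, ht1, ht2⟩ := hg
        refine ⟨s + t, add_mem hs ht, hs1.add ht1, ?_⟩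
        rw [mul_add r2 f g, ← hs2, ← ht2, map_add, smul_add]
        abel
      | smul c f _ hf =>
        obtain ⟨s, hs, hs1, hs2⟩ := hf
        refine ⟨c • s, Submodule.smul_mem _ c hs, ?_, ?_⟩
        · rw [MvPolynomial.smul_eq_C_mul]
          exact hs1.C_mul c
        · rw [mul_smul_comm, ← hs2, map_smul, smul_add, smul_comm c]
    obtain ⟨s, hs, hs1, hs2⟩ := key _ (ih (k - 2) (by omega) _ (isHomogeneous_lap hq))
    have h3 : q = (q - s) + s := by abel
    rw [h3]
    refine add_mem (Submodule.subset_span ⟨0, k, q - s, by simp, ⟨hq.sub hs1, ?_⟩, by simp⟩) hs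
    have h4 := lapS_eq_of_isHomogeneous hq
    rw [map_sub, h4, ← hs2]
    simp only [MvPolynomial.smul_eq_C_mul]
    simp
    ring

/-- On the sphere the powers of `r²` in the decomposition of each homogeneous component become `1`.
-/
theorem evalS_mem_span_harm (q : Poly) :
    evalS q ∈ Submodule.span ℝ {f : S2 → ℝ | ∃ j h, IsHarm j h ∧ f = evalS h} := by
  let T : Poly →ₗ[ℝ] (S2 → ℝ) :=
    { toFun := evalS
      map_add' := fun x y => by funext p; simp [evalS]
      map_smul' := fun c x => by funext p; simp [evalS, MvPolynomial.smul_eval] }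
  have h1 : ∀ k, ∀ q : Poly, q.IsHomogeneous k →
      T q ∈ Submodule.span ℝ {f : S2 → ℝ | ∃ j h, IsHarm j h ∧ f = evalS h} := by
    intro k q hq
    have h2 := Submodule.mem_map_of_mem (f := T) (mem_span_harm k q hq)
    rw [Submodule.map_span] at h2
    refine Submodule.span_mono ?_ h2
    rintro _ ⟨_, ⟨m, j, h, -, hh, rfl⟩, rfl⟩
    refine ⟨j, h, hh, ?_⟩
    funext p
    have : evalS (r2 ^ m * h) p = evalS r2 p ^ m * evalS h p := by simp [evalS]
    exact this.trans (by simp [evalS_r2])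
  change T q ∈ _
  rw [← sum_homogeneousComponent q, map_sum]
  exact Submodule.sum_mem _ fun i _ => h1 i _ (homogeneousComponent_isHomogeneous i q)

end Polynomials

/-! ### Orthogonality on the sphere -/

section Orthogonality

open MvPolynomial

theorem evalS_add (f g : Poly) (p : S2) : evalS (f + g) p = evalS f p + evalS g p := by
  simp [evalS]

theorem evalS_mul (f g : Poly) (p : S2) : evalS (f * g) p = evalS f p * evalS g p := by
  simp [evalS]

theorem evalS_sub (f g : Poly) (p : S2) : evalS (f - g) p = evalS f p - evalS g p := by
  simp [evalS]

theorem evalS_smul (c : ℝ) (f : Poly) (p : S2) : evalS (c • f) p = c * evalS f p := by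
  simp [evalS, smul_eval]

theorem evalS_X (i : Fin 3) (p : S2) : evalS (X i) p = (p : E3) i := by simp [evalS]

theorem evalS_C (a : ℝ) (p : S2) : evalS (C a) p = a := by simp [evalS]

theorem integral_evalS_mul_rotP (k : Fin 3) (f g : Poly) :
    ∫ p, evalS f p * evalS (rotP k g) p ∂area = -∫ p, evalS (rotP k f) p * evalS g p ∂area := by
  simpa only [angDeriv_evalS] using
    integral_mul_angDeriv (stdVec k) (isSmooth_evalS f) (isSmooth_evalS g)

theorem integrable_evalS_mul (f g : Poly) : Integrable (fun p => evalS f p * evalS g p) area :=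
  ((isSmooth_evalS f).mul (isSmooth_evalS g)).continuous.integrable_area

theorem integral_evalS_mul_lapS (f g : Poly) :
    ∫ p, evalS f p * evalS (lapS g) p ∂area = ∫ p, evalS (lapS f) p * evalS g p ∂area := by
  have h : ∀ k, ∫ p, evalS f p * evalS (rotP k (rotP k g)) p ∂area
      = ∫ p, evalS (rotP k (rotP k f)) p * evalS g p ∂area := fun k => by
    rw [integral_evalS_mul_rotP, integral_evalS_mul_rotP, neg_neg]
  have i1 := integrable_evalS_mul
  simp only [lapS_apply, evalS_add, mul_add, add_mul]
  rw [integral_add ((i1 _ _).fun_add (i1 _ _)) (i1 _ _), integral_add (i1 _ _) (i1 _ _),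
    integral_add ((i1 _ _).fun_add (i1 _ _)) (i1 _ _), integral_add (i1 _ _) (i1 _ _), h, h, h]

/-- Eigenfunctions of a symmetric operator with distinct eigenvalues are orthogonal. -/
theorem integral_eigen_mul_eq_zero {f g : Poly} {a b : ℝ} (hab : a ≠ b) (hf : lapS f = a • f)
    (hg : lapS g = b • g) : ∫ p, evalS f p * evalS g p ∂area = 0 := by
  have h := integral_evalS_mul_lapS f g
  simp only [hf, hg, evalS_smul, mul_assoc, mul_left_comm _ b, integral_const_mul] at h
  have h2 : (b - a) * ∫ p, evalS f p * evalS g p ∂area = 0 := by linear_combination h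
  exact (mul_eq_zero.mp h2).resolve_left (sub_ne_zero.mpr hab.symm)

theorem lapS_C (a : ℝ) : lapS (C a : Poly) = (0 : ℝ) • C a := by
  have h : ∀ k, rotP k (C a) = 0 := fun k => (rotP k).map_algebraMap _
  simp [lapS_apply, h]

theorem lapS_X (i : Fin 3) : lapS (X i : Poly) = (-2 : ℝ) • X i := by
  rw [lapS_eq_of_isHomogeneous (isHomogeneous_X ℝ i), smul_eq_C_mul]
  simp [lap, pderiv_X, Pi.single_apply, apply_ite]
  norm_num
  rfl

theorem area_pos : 0 < area.real Set.univ := by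
  rw [Measure.real, ENNReal.toReal_pos_iff]
  exact ⟨by
    rw [Measure.measure_univ_pos]
    exact Measure.toSphere_ne_zero _, measure_lt_top _ _⟩

theorem integral_coord (i : Fin 3) : ∫ p : S2, (p : E3) i ∂area = 0 := by
  have h := integral_eigen_mul_eq_zero (f := C 1) (g := X i) (by norm_num) (lapS_C 1) (lapS_X i)
  simpa only [evalS_X, evalS_C, one_mul] using h

/-- Skewness of the rotational derivatives on coordinate functions kills the mixed moments and
equates the square moments, whose sum is the total area because `∑ x_i² = 1`. -/
theorem integral_coord_mul (i j : Fin 3) :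
    ∫ p : S2, (p : E3) i * (p : E3) j ∂area = if i = j then area.real Set.univ / 3 else 0 := by
  have r : ∀ k, ∀ i j : Fin 3, ∫ p, evalS (X i) p * evalS (rotP k (X j)) p ∂area
      = -∫ p, evalS (rotP k (X i)) p * evalS (X j) p ∂area :=
    fun k i j => integral_evalS_mul_rotP k (X i) (X j)
  have s : ∀ i j : Fin 3, ∫ p : S2, (p : E3) i * (p : E3) j ∂area
      = ∫ p : S2, (p : E3) j * (p : E3) i ∂area := fun i j => by simp only [mul_comm]
  have a01 := r 2 0 0
  have a02 := r 1 0 0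
  have a12 := r 0 1 1
  have b01 := r 2 0 1
  have b12 := r 0 1 2
  simp [rotP_zero, rotP_one, rotP_two, pderiv_X, evalS, integral_neg]
    at a01 a02 a12 b01 b12
  have i1 : ∀ i j : Fin 3, Integrable (fun p : S2 => (p : E3) i * (p : E3) j) area := fun i j => by
    simpa only [evalS_X] using integrable_evalS_mul (X i) (X j)
  have t : (∫ p : S2, (p : E3) 0 * (p : E3) 0 ∂area) + (∫ p : S2, (p : E3) 1 * (p : E3) 1 ∂area)
      + (∫ p : S2, (p : E3) 2 * (p : E3) 2 ∂area) = area.real Set.univ := by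
    rw [← integral_add (i1 _ _) (i1 _ _), ← integral_add ((i1 _ _).fun_add (i1 _ _)) (i1 _ _)]
    have : ∀ p : S2, (p : E3) 0 * (p : E3) 0 + (p : E3) 1 * (p : E3) 1 + (p : E3) 2 * (p : E3) 2
        = 1 := fun p => by linear_combination sum_sq_coe p
    simp only [this, integral_const, smul_eq_mul, mul_one]
  have s01 := s 0 1
  have s02 := s 0 2
  have s12 := s 1 2
  fin_cases i <;> fin_cases j <;> simp [-Measure.toSphere_real_apply_univ] <;> linarith

/-- A continuous function orthogonal to all polynomials vanishes. -/
theorem eq_zero_of_orthogonal_evalS {φ : S2 → ℝ} (hφ : Continuous φ)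
    (h : ∀ q : Poly, ∫ p, φ p * evalS q p ∂area = 0) : φ = 0 := by
  let coord : Fin 3 → C(S2, ℝ) := fun i => ⟨fun p => (p : E3) i, by fun_prop⟩
  let A : Subalgebra ℝ C(S2, ℝ) := (aeval coord : Poly →ₐ[ℝ] C(S2, ℝ)).range
  have hA : A.SeparatesPoints := by
    intro p q hpq
    have : ∃ i, (p : E3) i ≠ (q : E3) i := by
      by_contra! hc
      exact hpq (Subtype.ext (by ext i; exact hc i))
    obtain ⟨i, hi⟩ := this
    exact ⟨coord i, ⟨coord i, ⟨X i, by simp⟩, rfl⟩, hi⟩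
  have hev : ∀ (q : Poly) (p : S2), (aeval coord q : C(S2, ℝ)) p = evalS q p := by
    intro q p
    induction q using MvPolynomial.induction_on with
    | C a => simp [evalS]
    | add f g hf hg => simp [evalS_add, hf, hg]
    | mul_X f i hf => simp [evalS_mul, evalS_X, hf, coord]
  have i2 : ∀ q, Integrable (fun p => φ p * evalS q p) area := fun q =>
    Continuous.integrable_area (by have := (isSmooth_evalS q).continuous; fun_prop)
  have isq : Integrable (fun p => φ p * φ p) area := Continuous.integrable_area (by fun_prop)
  have iabs : Integrable (fun p => |φ p|) area := Continuous.integrable_area (by fun_prop)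
  -- By Stone-Weierstrass a polynomial lies uniformly within `ε` of `φ`; subtracting it does not
  -- change the pairing with `φ`.
  have hle : ∀ ε > 0, ∫ p, φ p * φ p ∂area ≤ ε * ∫ p, |φ p| ∂area := by
    intro ε hε
    obtain ⟨⟨g, q, rfl⟩, hg⟩ :=
      ContinuousMap.exists_mem_subalgebra_near_continuous_of_separatesPoints A hA φ hφ ε hε
    have h1 : ∫ p, φ p * φ p ∂area = ∫ p, (φ p * φ p - φ p * evalS q p) ∂area := by
      rw [integral_sub isq (i2 q), h q, sub_zero]
    rw [h1, ← integral_const_mul]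
    refine integral_mono (isq.sub (i2 q)) (iabs.const_mul ε) fun p => ?_
    have h2 : |evalS q p - φ p| < ε := by
      have := hg p
      rw [Real.norm_eq_abs] at this
      rwa [← hev]
    have h3 : φ p * φ p - φ p * evalS q p = -(evalS q p - φ p) * φ p := by ring
    change φ p * φ p - φ p * evalS q p ≤ ε * |φ p|
    rw [h3]
    calc -(evalS q p - φ p) * φ p ≤ |-(evalS q p - φ p) * φ p| := le_abs_self _
      _ = |evalS q p - φ p| * |φ p| := by rw [abs_mul, abs_neg]
      _ ≤ ε * |φ p| := by gcongr
  have h0 : ∫ p, φ p * φ p ∂area ≤ 0 := by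
    have hI : 0 ≤ ∫ p, |φ p| ∂area := integral_nonneg fun p => abs_nonneg _
    refine le_of_forall_pos_le_add fun δ hδ => ?_
    have := hle (δ / ((∫ p, |φ p| ∂area) + 1)) (by positivity)
    refine this.trans ?_
    rw [zero_add, div_mul_eq_mul_div, div_le_iff₀ (by positivity)]
    nlinarith
  have h1 : ∫ p, φ p * φ p ∂area = 0 :=
    le_antisymm h0 (integral_nonneg fun p => mul_self_nonneg _)
  rw [integral_eq_zero_iff_of_nonneg (fun p => mul_self_nonneg _) isq] at h1
  have h2 : (fun p => φ p * φ p) = 0 :=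
    (Continuous.ae_eq_iff_eq area (by fun_prop) continuous_const).mp h1
  funext p
  exact mul_self_eq_zero.mp (congrFun h2 p)

theorem integral_mul_eq_zero_of_mem_span {φ : S2 → ℝ} (hφ : Continuous φ) {s : Set (S2 → ℝ)}
    (hs : ∀ f ∈ s, Continuous f ∧ ∫ p, φ p * f p ∂area = 0) {f : S2 → ℝ}
    (hf : f ∈ Submodule.span ℝ s) : Continuous f ∧ ∫ p, φ p * f p ∂area = 0 := by
  induction hf using Submodule.span_induction with
  | mem f hf => exact hs f hf
  | zero => exact ⟨continuous_const, by simp⟩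
  | add f g _ _ hf hg =>
    obtain ⟨hf1, hf2⟩ := hf
    obtain ⟨hg1, hg2⟩ := hg
    refine ⟨hf1.add hg1, ?_⟩
    simp only [Pi.add_apply, mul_add]
    rw [integral_add (Continuous.integrable_area (by fun_prop))
      (Continuous.integrable_area (by fun_prop)), hf2, hg2, add_zero]
  | smul a f _ hf =>
    refine ⟨hf.1.const_smul a, ?_⟩
    simp only [Pi.smul_apply, smul_eq_mul, mul_left_comm _ a, integral_const_mul, hf.2, mul_zero]

/-- A continuous function orthogonal to the spherical harmonics of degree at least two is affine. -/
theorem exists_affine_of_orthogonal_harm {φ : S2 → ℝ} (hφ : Continuous φ)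
    (h : ∀ l, 2 ≤ l → ∀ q, IsHarm l q → ∫ p, φ p * evalS q p ∂area = 0) :
    ∃ (c : ℝ) (w : E3), ∀ p : S2, φ p = c + inner ℝ w (p : E3) := by
  have hNp := area_pos
  -- The affine function is the `L²` projection of `φ` onto degrees at most one: the constant and
  -- the coordinates are orthogonal, with square norms the area and a third of it.
  obtain ⟨c, hc⟩ : ∃ c, c * area.real Set.univ = ∫ p, φ p ∂area :=
    ⟨(∫ p, φ p ∂area) / area.real Set.univ, div_mul_cancel₀ _ hNp.ne'⟩
  obtain ⟨w, hw⟩ : ∃ w : E3, ∀ i, w i * (area.real Set.univ / 3)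
      = ∫ p : S2, φ p * (p : E3) i ∂area :=
    ⟨WithLp.toLp 2 fun i => (∫ p : S2, φ p * (p : E3) i ∂area) / (area.real Set.univ / 3),
      fun i => div_mul_cancel₀ _ (by positivity)⟩
  obtain ⟨lin, hlin⟩ : ∃ lin : Poly, lin = C c + ∑ i, C (w i) * X i := ⟨_, rfl⟩
  have hlin1 : ∀ p : S2, evalS lin p = c + inner ℝ w (p : E3) := by
    intro p
    simp [hlin, evalS, Fin.sum_univ_three, inner_eq_coord]
  have hcl := (isSmooth_evalS lin).continuous
  have hc' : Continuous fun p => φ p - evalS lin p := by fun_prop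
  have i1 : ∀ q, Integrable (fun p => φ p * evalS q p) area := fun q =>
    Continuous.integrable_area (by have := (isSmooth_evalS q).continuous; fun_prop)
  have hsub : ∀ q, ∫ p, (φ p - evalS lin p) * evalS q p ∂area
      = (∫ p, φ p * evalS q p ∂area) - ∫ p, evalS lin p * evalS q p ∂area := fun q => by
    simp only [sub_mul]
    exact integral_sub (i1 q) (integrable_evalS_mul lin q)
  have hlinq : ∀ q, ∫ p, evalS lin p * evalS q p ∂area
      = c * (∫ p, evalS q p ∂area) + ∑ i, w i * ∫ p : S2, (p : E3) i * evalS q p ∂area := by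
    intro q
    have e : ∀ p, evalS lin p * evalS q p
        = c * evalS q p + ∑ i, w i * ((p : E3) i * evalS q p) := fun p => by
      simp [hlin, evalS, Fin.sum_univ_three]; ring
    have i2 : ∀ i : Fin 3, Integrable (fun p : S2 => w i * ((p : E3) i * evalS q p)) area :=
      fun i => by
        have := (integrable_evalS_mul (X i) q).const_mul (w i)
        simpa only [evalS_X] using this
    simp only [e]
    rw [integral_add ((isSmooth_evalS q).continuous.integrable_area.const_mul c)
      (integrable_finsetSum _ fun i _ => i2 i), integral_finsetSum _ fun i _ => i2 i]
    simp only [integral_const_mul]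
  have hX : ∀ i : Fin 3, ∫ p, (φ p - evalS lin p) * evalS (X i) p ∂area = 0 := by
    intro i
    rw [hsub, hlinq]
    simp only [evalS_X, integral_coord, integral_coord_mul]
    simp only [mul_zero, zero_add, mul_ite, Finset.sum_ite_eq', Finset.mem_univ, if_true]
    rw [hw, sub_self]
  have hC : ∀ a : ℝ, ∫ p, (φ p - evalS lin p) * evalS (C a) p ∂area = 0 := by
    intro a
    rw [hsub, hlinq]
    simp only [evalS_C, integral_mul_const, integral_coord, integral_const, smul_eq_mul]
    simp only [zero_mul, mul_zero, Finset.sum_const_zero]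
    linear_combination -a * hc
  have hall : ∀ l q, IsHarm l q → ∫ p, (φ p - evalS lin p) * evalS q p ∂area = 0 := by
    intro l q hq
    -- In degrees `0` and `1` orthogonality comes from the choice of `c` and `w`. In degree at least
    -- two the eigenvalue `-l(l + 1)` differs from `0` and `-2`, so the affine part contributes
    -- nothing.
    rcases lt_or_ge l 2 with hl | hl
    · interval_cases l
      · have h3 := hq.1
        rw [← totalDegree_zero_iff_isHomogeneous, totalDegree_eq_zero_iff_eq_C] at h3
        rw [h3]
        exact hC _
      · have h3 : q = ∑ i, C (coeff 0 (pderiv i q)) * X i := by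
          have h4 := euler hq.1
          have h5 : ∀ i, pderiv i q = C (coeff 0 (pderiv i q)) := fun i => by
            rw [← totalDegree_eq_zero_iff_eq_C, totalDegree_zero_iff_isHomogeneous]
            exact hq.1.pderiv
          rw [Fin.sum_univ_three, ← h5, ← h5, ← h5]
          linear_combination -h4
        have h6 : evalS q ∈ Submodule.span ℝ (Set.range fun i : Fin 3 => evalS (X i)) := by
          have : evalS q = ∑ i, coeff 0 (pderiv i q) • evalS (X i) := by
            funext p
            conv_lhs => rw [h3]
            simp [evalS]
          rw [this]
          exact Submodule.sum_mem _ fun i _ =>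
            Submodule.smul_mem _ _ (Submodule.subset_span ⟨i, rfl⟩)
        refine (integral_mul_eq_zero_of_mem_span hc' ?_ h6).2
        rintro _ ⟨i, rfl⟩
        exact ⟨(isSmooth_evalS _).continuous, hX i⟩
    · have hl' : (2 : ℝ) ≤ l := by exact_mod_cast hl
      have h0 := integral_eigen_mul_eq_zero (f := C 1) (by nlinarith) (lapS_C 1) hq.2
      have h1 := fun i => integral_eigen_mul_eq_zero (f := X i) (by nlinarith) (lapS_X i) hq.2
      simp only [evalS_C, one_mul, evalS_X] at h0 h1
      rw [hsub, hlinq, h l hl q hq, h0]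
      simp [h1]
  have h0 := eq_zero_of_orthogonal_evalS hc' fun q => by
    refine (integral_mul_eq_zero_of_mem_span hc' ?_ (evalS_mem_span_harm q)).2
    rintro _ ⟨j, h, hh, rfl⟩
    exact ⟨(isSmooth_evalS _).continuous, hall j h hh⟩
  refine ⟨c, w, fun p => ?_⟩
  rw [← hlin1]
  exact sub_eq_zero.mp (congrFun h0 p)

end Orthogonality

/-! ### Sums over orthonormal frames -/

section Frames

variable {G : Type*} [AddCommGroup G] [Module ℝ G]

theorem eq_sum_stdVec (v : E3) : v = v 0 • stdVec 0 + v 1 • stdVec 1 + v 2 • stdVec 2 := by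
  ext i; fin_cases i <;> simp [stdVec]

theorem starProjection_tangent (p : S2) (w : E3) :
    (tangent p).starProjection w = w - inner ℝ (p : E3) w • (p : E3) := by
  rw [tangent, Submodule.starProjection_orthogonal_val,
    Submodule.starProjection_unit_singleton ℝ (norm_coe p)]

theorem sum_inner_frame (p : S2) (w : E3) :
    ∑ i, inner ℝ (frame p i : E3) w • (frame p i : E3) = w - inner ℝ (p : E3) w • (p : E3) := by
  rw [← starProjection_tangent, Submodule.starProjection_apply,
    (frame p).orthogonalProjectionOnto_apply_eq_sum]
  simp

/-- The trace over the tangent plane, in terms of the standard basis of `ℝ³`. -/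
theorem sum_frame (p : S2) (B : E3 →ₗ[ℝ] E3 →ₗ[ℝ] G) :
    ∑ i, B (frame p i) (frame p i)
      = B (stdVec 0) (stdVec 0) + B (stdVec 1) (stdVec 1) + B (stdVec 2) (stdVec 2) - B p p := by
  have h1 : ∀ k : Fin 3, ∑ i, (frame p i : E3) k • (frame p i : E3)
      = stdVec k - (p : E3) k • (p : E3) := fun k => by
    have := sum_inner_frame p (stdVec k)
    simpa [stdVec, EuclideanSpace.inner_single_right] using this
  have h2 : ∀ i, B (frame p i) (frame p i) = B (stdVec 0) ((frame p i : E3) 0 • (frame p i : E3))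
      + B (stdVec 1) ((frame p i : E3) 1 • (frame p i : E3))
      + B (stdVec 2) ((frame p i : E3) 2 • (frame p i : E3)) := fun i => by
    conv_lhs => enter [1]; rw [eq_sum_stdVec (frame p i : E3)]
    simp only [map_add, map_smul, LinearMap.add_apply, LinearMap.smul_apply]
  have h3 : B (p : E3) (p : E3) = (p : E3) 0 • B (stdVec 0) p + (p : E3) 1 • B (stdVec 1) p
      + (p : E3) 2 • B (stdVec 2) p := by
    conv_lhs => enter [1]; rw [eq_sum_stdVec (p : E3)]
    simp only [map_add, map_smul, LinearMap.add_apply, LinearMap.smul_apply]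
  rw [Finset.sum_congr rfl fun i _ => h2 i, Finset.sum_add_distrib, Finset.sum_add_distrib,
    ← map_sum, ← map_sum, ← map_sum, h1, h1, h1, h3]
  simp only [map_sub, map_smul]
  abel

/-- The vectors `e_k × p` form a Parseval frame of the tangent plane, so they may replace an
orthonormal frame in any trace. -/
theorem sum_cross (p : S2) (B : E3 →ₗ[ℝ] E3 →ₗ[ℝ] G) :
    B (cross (stdVec 0) p) (cross (stdVec 0) p) + B (cross (stdVec 1) p) (cross (stdVec 1) p)
        + B (cross (stdVec 2) p) (cross (stdVec 2) p)
      = B (stdVec 0) (stdVec 0) + B (stdVec 1) (stdVec 1) + B (stdVec 2) (stdVec 2) - B p p := by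
  have c0 : cross (stdVec 0) p = -(p : E3) 2 • stdVec 1 + (p : E3) 1 • stdVec 2 := by
    ext i; fin_cases i <;> simp [stdVec]
  have c1 : cross (stdVec 1) p = (p : E3) 2 • stdVec 0 - (p : E3) 0 • stdVec 2 := by
    ext i; fin_cases i <;> simp [stdVec]
  have c2 : cross (stdVec 2) p = -(p : E3) 1 • stdVec 0 + (p : E3) 0 • stdVec 1 := by
    ext i; fin_cases i <;> simp [stdVec]
  have h3 : B (p : E3) (p : E3) = B ((p : E3) 0 • stdVec 0 + (p : E3) 1 • stdVec 1
      + (p : E3) 2 • stdVec 2) ((p : E3) 0 • stdVec 0 + (p : E3) 1 • stdVec 1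
      + (p : E3) 2 • stdVec 2) := by rw [← eq_sum_stdVec]
  rw [h3, c0, c1, c2]
  simp only [map_add, map_sub, map_smul, LinearMap.add_apply, LinearMap.sub_apply,
    LinearMap.smul_apply]
  linear_combination (norm := module) (sum_sq_coe p) •
    (B (stdVec 0) (stdVec 0) + B (stdVec 1) (stdVec 1) + B (stdVec 2) (stdVec 2))

end Frames

/-! ### Divergence and curl -/

theorem IsSmooth.bilin {F G H : Type*} [NormedAddCommGroup F] [NormedSpace ℝ F]
    [NormedAddCommGroup G] [NormedSpace ℝ G] [NormedAddCommGroup H] [NormedSpace ℝ H]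
    (B : F →L[ℝ] G →L[ℝ] H) {f : S2 → F} {g : S2 → G} (hf : IsSmooth f) (hg : IsSmooth g) :
    IsSmooth (fun q => B (f q) (g q)) :=
  (B.isBoundedBilinearMap.contDiff).comp_isSmooth (hf.prodMk hg)

theorem dirDeriv_bilin {F G H : Type*} [NormedAddCommGroup F] [NormedSpace ℝ F]
    [NormedAddCommGroup G] [NormedSpace ℝ G] [NormedAddCommGroup H] [NormedSpace ℝ H]
    (B : F →L[ℝ] G →L[ℝ] H) {f : S2 → F} {g : S2 → G} (hf : IsSmooth f) (hg : IsSmooth g)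
    {p : S2} {v : E3} (hv : v ∈ tangent p) :
    dirDeriv (fun q => B (f q) (g q)) p v
      = B (dirDeriv f p v) (g p) + B (f p) (dirDeriv g p v) := by
  refine (hf.bilin B hg).dirDeriv_eq hv ?_
  have h := (B.hasFDerivAt.comp_hasDerivAt (0 : ℝ) (hf.hasDerivAt_curve hv)).clm_apply
    (hg.hasDerivAt_curve hv)
  simpa only [Function.comp, curve_zero] using h

/-- The cross product as a bilinear map. -/
def crossB : E3 →L[ℝ] E3 →L[ℝ] E3 :=
  LinearMap.toContinuousLinearMap
    { toFun := crossL
      map_add' := fun x y => by ext v i; fin_cases i <;> simp <;> ring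
      map_smul' := fun c x => by ext v i; fin_cases i <;> simp <;> ring }

/-- The curl of a tangent vector field. -/
def curl (X : S2 → E3) (p : S2) : ℝ := ∑ k, angDeriv (stdVec k) X p k

theorem inner_covDeriv (X : S2 → E3) (p : S2) (u : E3) {v : E3} (hv : v ∈ tangent p) :
    inner ℝ (covDeriv X p u) v = inner ℝ (dirDeriv X p u) v := by
  rw [covDeriv, Submodule.inner_starProjection_left_eq_right,
    Submodule.starProjection_eq_self_iff.mpr hv]

/-- The divergence becomes the curl of the field rotated by a quarter turn, a sum of rotational
derivatives that can be integrated by parts. Differentiating the factor `q` only contributes a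
multiple of `p · X`, which vanishes by tangency. -/
theorem divergence_eq {X : S2 → E3} (hX : IsSmooth X) (hT : ∀ p, X p ∈ tangent p) (p : S2) :
    divergence X p = ∑ k, angDeriv (stdVec k) (fun q => cross q (X q)) p k := by
  have h1 : divergence X p = ∑ i, inner ℝ (dirDeriv X p (frame p i)) (frame p i : E3) :=
    Finset.sum_congr rfl fun i _ => inner_covDeriv X p _ (frame p i).2
  let A : E3 →L[ℝ] E3 := fderiv ℝ (radialExt X) p
  have hA : ∀ v, dirDeriv X p v = A v := fun v => rfl
  let B : E3 →ₗ[ℝ] E3 →ₗ[ℝ] ℝ := (innerₗ E3).compl₁₂ A.toLinearMap LinearMap.id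
  have hB : ∀ u v, B u v = inner ℝ (A u) v := fun u v => rfl
  have h2 : divergence X p = B (cross (stdVec 0) p) (cross (stdVec 0) p)
      + B (cross (stdVec 1) p) (cross (stdVec 1) p)
      + B (cross (stdVec 2) p) (cross (stdVec 2) p) := by
    rw [h1, sum_cross, ← sum_frame]
    rfl
  have h3 : ∀ w, angDeriv w (fun q => cross q (X q)) p
      = cross (cross w p) (X p) + cross p (A (cross w p)) := fun w => by
    have := dirDeriv_bilin crossB isSmooth_coe hX (cross_mem_tangent w p)
    rw [dirDeriv_coe (cross_mem_tangent w p)] at this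
    exact this
  rw [h2]
  simp only [h3, Fin.sum_univ_three, hB, inner_eq_coord]
  have h4 := mem_tangent_iff_coord.mp (hT p)
  simp [stdVec]
  linear_combination 2 * h4

theorem IsSmooth.coord {X : S2 → E3} (hX : IsSmooth X) (k : Fin 3) : IsSmooth (fun p => X p k) :=
  (EuclideanSpace.proj k : E3 →L[ℝ] ℝ).contDiff.comp_isSmooth hX

theorem angDeriv_coord {X : S2 → E3} (hX : IsSmooth X) (w : E3) (k : Fin 3) :
    angDeriv w (fun q => X q k) = fun p => angDeriv w X p k := by
  funext p
  exact dirDeriv_clm_comp (EuclideanSpace.proj k : E3 →L[ℝ] ℝ) hX (cross_mem_tangent w p)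

theorem integral_sum_angDeriv_mul {Y : S2 → E3} (hY : IsSmooth Y) {g : S2 → ℝ} (hg : IsSmooth g) :
    ∫ p, (∑ k, angDeriv (stdVec k) Y p k) * g p ∂area
      = -∫ p, ∑ k, Y p k * angDeriv (stdVec k) g p ∂area := by
  have h : ∀ k, ∫ p, angDeriv (stdVec k) Y p k * g p ∂area
      = -∫ p, Y p k * angDeriv (stdVec k) g p ∂area := fun k => by
    rw [integral_mul_angDeriv (stdVec k) (hY.coord k) hg, neg_neg, angDeriv_coord hY]
  simp only [Finset.sum_mul]
  rw [integral_finsetSum _ fun k _ =>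
      (((hY.angDeriv (stdVec k)).coord k).mul hg).continuous.integrable_area,
    integral_finsetSum _ fun k _ =>
      ((hY.coord k).mul (hg.angDeriv (stdVec k))).continuous.integrable_area,
    ← Finset.sum_neg_distrib]
  exact Finset.sum_congr rfl fun k _ => h k

theorem integral_curl_mul {X : S2 → E3} (hX : IsSmooth X) {g : S2 → ℝ} (hg : IsSmooth g) :
    ∫ p, curl X p * g p ∂area = -∫ p, ∑ k, X p k * angDeriv (stdVec k) g p ∂area :=
  integral_sum_angDeriv_mul hX hg

theorem isSmooth_cross {Y : S2 → E3} (hY : IsSmooth Y) : IsSmooth (fun q : S2 => cross q (Y q)) :=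
  isSmooth_coe.bilin crossB hY

/-- The integrand is `(p × X) · (p × ∇g) = X · ∇g`, so this says that a divergence-free field is
orthogonal to gradients. -/
theorem integral_sum_cross_mul_angDeriv {X : S2 → E3} (hX : IsSmooth X)
    (hT : ∀ p, X p ∈ tangent p) (hD : ∀ p, divergence X p = 0) {g : S2 → ℝ} (hg : IsSmooth g) :
    ∫ p, ∑ k, cross p (X p) k * angDeriv (stdVec k) g p ∂area = 0 := by
  have h := integral_sum_angDeriv_mul (isSmooth_cross hX) hg
  simp only [← divergence_eq hX hT, hD, zero_mul, integral_zero] at h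
  linarith

/-! ### Consequences of orthogonality to rotated gradients of spherical harmonics -/

section Harmonic

open MvPolynomial

theorem integrable_sum_mul_evalS_rotP {Y : S2 → E3} (hY : IsSmooth Y) (g : Poly) :
    Integrable (fun p => ∑ k, Y p k * evalS (rotP k g) p) area :=
  Continuous.integrable_area <|
    continuous_finsetSum _ fun k _ => ((hY.coord k).mul (isSmooth_evalS _)).continuous

theorem cross_cross_self {p : S2} {v : E3} (hv : v ∈ tangent p) : cross (cross p v) p = v := by
  have h2 := mem_tangent_iff_coord.mp hv
  have h3 := sum_sq_coe p
  ext i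
  fin_cases i
  · simp
    linear_combination v 0 * h3 - (p : E3) 0 * h2
  · simp
    linear_combination v 1 * h3 - (p : E3) 1 * h2
  · simp
    linear_combination v 2 * h3 - (p : E3) 2 * h2

/-- The polynomial `r² ∂_m g - x_m (x · ∇g)` restricts to the `m`-th Cartesian component of the
spherical gradient of `g`. The identity splits `v_m lapS g` into the pairing of `v` with the
gradient of that component and with the rotated gradient of `R_m g`; for divergence-free fields both
can be controlled after integration. -/
theorem coord_mul_lapS {p : S2} {v : E3} (hv : v ∈ tangent p) (g : Poly) (m : Fin 3) :
    v m * evalS (lapS g) p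
      = (∑ k, cross p v k * evalS (rotP k (r2 * pderiv m g
          - X m * (X 0 * pderiv 0 g + X 1 * pderiv 1 g + X 2 * pderiv 2 g))) p)
        + ∑ k, v k * evalS (rotP k (rotP m g)) p := by
  -- Writing the tangent vector as `v = Z × p` with `Z = p × v` builds tangency in, so that a
  -- polynomial identity free of constraints remains.
  obtain ⟨Z, hZ⟩ : ∃ Z, Z = cross p v := ⟨_, rfl⟩
  rw [← hZ, ← cross_cross_self hv, ← hZ]
  simp only [Fin.sum_univ_three, lapS_apply, r2]
  fin_cases m <;>
  · simp only [Fin.zero_eta, Fin.mk_one, Fin.reduceFinMk, rotP_zero, rotP_one, rotP_two, map_sub,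
      map_add, pderiv_mul, pderiv_X, pderiv_pow, pderiv_comm 1 0, pderiv_comm 2 0, pderiv_comm 2 1]
    simp [evalS]
    ring

/-- In `coord_mul_lapS` the gradient term integrates to zero because `Y` is divergence-free, and the
other because `R_m g` is again harmonic of degree `l`. What remains is `-l(l + 1)` times the
integral. -/
theorem integral_coord_mul_harm {Y : S2 → E3} (hY : IsSmooth Y) (hT : ∀ p, Y p ∈ tangent p)
    (hD : ∀ p, divergence Y p = 0)
    (h : ∀ l, 2 ≤ l → ∀ g, IsHarm l g → ∫ p, ∑ k, Y p k * evalS (rotP k g) p ∂area = 0)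
    {l : ℕ} (hl : 2 ≤ l) {g : Poly} (hg : IsHarm l g) (m : Fin 3) :
    ∫ p, Y p m * evalS g p ∂area = 0 := by
  have h1 := integral_congr_ae (μ := area)
    (Filter.Eventually.of_forall fun p => coord_mul_lapS (hT p) g m)
  rw [integral_add (integrable_sum_mul_evalS_rotP (isSmooth_cross hY) _)
    (integrable_sum_mul_evalS_rotP hY _), h l hl _ (hg.rotP m)] at h1
  have h2 := integral_sum_cross_mul_angDeriv hY hT hD (isSmooth_evalS (r2 * pderiv m g
          - X m * (X 0 * pderiv 0 g + X 1 * pderiv 1 g + X 2 * pderiv 2 g)))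
  simp only [angDeriv_evalS] at h2
  rw [h2] at h1
  simp only [hg.2, evalS_smul, mul_left_comm _ (-((l : ℝ) * (l + 1))), integral_const_mul,
    add_zero] at h1
  have hl' : (2 : ℝ) ≤ l := by exact_mod_cast hl
  refine (mul_eq_zero.mp h1).resolve_left ?_
  nlinarith

/-- A divergence-free field orthogonal to the rotated gradients of all spherical harmonics of
degree at least two is a Killing field. -/
theorem isKilling_of_orthogonal {Y : S2 → E3} (hY : IsSmooth Y) (hT : ∀ p, Y p ∈ tangent p)
    (hD : ∀ p, divergence Y p = 0)
    (h : ∀ l, 2 ≤ l → ∀ g, IsHarm l g → ∫ p, ∑ k, Y p k * evalS (rotP k g) p ∂area = 0) :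
    IsKilling Y := by
  have h1 := fun m => exists_affine_of_orthogonal_harm (hY.coord m).continuous
    fun l hl q hq => integral_coord_mul_harm hY hT hD h hl hq m
  choose c w hcw using h1
  have h2 : ∀ p : S2, (∑ m, (p : E3) m * c m) + ∑ m, (p : E3) m * inner ℝ (w m) (p : E3) = 0 := by
    intro p
    have := mem_tangent_iff_coord.mp (hT p)
    rw [hcw, hcw, hcw] at this
    simp only [Fin.sum_univ_three]
    linear_combination this
  let A : E3 →L[ℝ] E3 := LinearMap.toContinuousLinearMap
    { toFun := fun x => WithLp.toLp 2 fun m => inner ℝ (w m) x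
      map_add' := fun x y => by ext m; simp [inner_add_right]
      map_smul' := fun a x => by ext m; simp [inner_smul_right] }
  have hA : ∀ x m, A x m = inner ℝ (w m) x := fun x m => rfl
  have hYA : Y = fun p : S2 => WithLp.toLp 2 c + A p := by
    funext p
    ext m
    simp [hcw m p, hA]
  have hdY : ∀ p : S2, ∀ u ∈ tangent p, dirDeriv Y p u = A u := by
    intro p u hu
    have hs : ContDiff ℝ ∞ (fun x : E3 => WithLp.toLp 2 c + A x) := contDiff_const.add A.contDiff
    rw [hYA, dirDeriv_restrict hs hu, fderiv_const_add, A.fderiv]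
  -- Tangency reads `p · c + p · Ap = 0`; averaging over `p` and `-p` isolates the quadratic part,
  -- so `A` is skew.
  have hneg : ∀ p : S2, inner ℝ (p : E3) (A p) = 0 := by
    intro p
    have a := h2 p
    have b := h2 (-p)
    simp only [Metric.sphere, coe_neg_sphere, PiLp.neg_apply, inner_neg_right, Fin.sum_univ_three]
      at a b
    rw [inner_eq_coord, hA, hA, hA]
    linear_combination (1 / 2 : ℝ) * a + (1 / 2 : ℝ) * b
  have hall : ∀ x : E3, inner ℝ x (A x) = 0 := by
    intro x
    by_cases hx : x = 0
    · simp [hx]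
    · have := hneg ⟨‖x‖⁻¹ • x, normalize_mem hx⟩
      simp only [map_smul, inner_smul_left, inner_smul_right] at this
      simpa [hx] using this
  intro p u hu v hv
  have hu' := inner_covDeriv Y p u hv
  have hv' := inner_covDeriv Y p v hu
  rw [real_inner_comm] at hv'
  rw [hu', hv', hdY p u hu, hdY p v hv]
  have huv := hall (u + v)
  simp only [map_add, inner_add_left, inner_add_right, hall] at huv
  rw [real_inner_comm (A v), real_inner_comm v (A u)] at *
  linarith

end Harmonic

/-! ### Spinor algebra -/

/-- The Pauli matrix of a vector as an operator on spinors. -/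
def sig (v : E3) : Spinor →ₗ[ℂ] Spinor := Matrix.toEuclideanLin (pauli v)

theorem sig_apply_zero (v : E3) (s : Spinor) :
    sig v s 0 = (v 2 : ℂ) * s 0 + ((v 0 : ℂ) - Complex.I * (v 1 : ℂ)) * s 1 := by
  simp [sig, pauli, Matrix.toLpLin_apply, dotProduct, Fin.sum_univ_two]

theorem sig_apply_one (v : E3) (s : Spinor) :
    sig v s 1 = ((v 0 : ℂ) + Complex.I * (v 1 : ℂ)) * s 0 - (v 2 : ℂ) * s 1 := by
  simp [sig, pauli, Matrix.toLpLin_apply, dotProduct, Fin.sum_univ_two]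
  ring

theorem spinor_ext {s t : Spinor} (h0 : s 0 = t 0) (h1 : s 1 = t 1) : s = t := by
  ext i; fin_cases i <;> assumption

theorem cliff_apply (v : E3) (s : Spinor) : cliff v s = -Complex.I • sig v s := rfl

theorem sig_add_left (u v : E3) (s : Spinor) : sig (u + v) s = sig u s + sig v s := by
  apply spinor_ext <;> simp [sig_apply_zero, sig_apply_one] <;> ring

theorem sig_smul_left (c : ℝ) (v : E3) (s : Spinor) : sig (c • v) s = c • sig v s := by
  apply spinor_ext <;> simp [sig_apply_zero, sig_apply_one] <;> ring

theorem sig_sig (u v : E3) (s : Spinor) :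
    sig u (sig v s) = ((inner ℝ u v : ℝ) : ℂ) • s + Complex.I • sig (cross u v) s := by
  rw [inner_eq_coord]
  apply spinor_ext <;> simp [sig_apply_zero, sig_apply_one]
  · linear_combination (-(u 1 * v 1 * s 0) + (u 2 * v 0 - u 0 * v 2) * s 1 : ℂ) * Complex.I_sq
  · linear_combination (-(u 1 * v 1 * s 1) + (u 0 * v 2 - u 2 * v 0) * s 0 : ℂ) * Complex.I_sq

theorem sig_coe_sig_coe (p : S2) (s : Spinor) : sig p (sig p s) = s := by
  have h : cross (p : E3) p = 0 := by ext i; fin_cases i <;> simp <;> ring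
  have h2 : sig 0 s = 0 := by apply spinor_ext <;> simp [sig_apply_zero, sig_apply_one]
  rw [sig_sig, h, h2]
  simp

theorem inner_spinor (s t : Spinor) :
    inner ℂ s t = (starRingEnd ℂ) (s 0) * t 0 + (starRingEnd ℂ) (s 1) * t 1 := by
  simp [PiLp.inner_apply, Fin.sum_univ_two, mul_comm]

theorem inner_sig (v : E3) (s t : Spinor) : inner ℂ (sig v s) t = inner ℂ s (sig v t) := by
  rw [inner_spinor, inner_spinor]
  simp [sig_apply_zero, sig_apply_one]
  ring

theorem cross_anticomm (u v : E3) : cross u v = (-1 : ℝ) • cross v u := by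
  ext i; fin_cases i <;> simp <;> ring

theorem sig_anticomm {p : S2} {v : E3} (hv : v ∈ tangent p) (s : Spinor) :
    sig p (sig v s) = -sig v (sig p s) := by
  have h1 : inner ℝ (p : E3) v = 0 := mem_tangent_iff.mp hv
  rw [sig_sig, sig_sig, real_inner_comm p.1, h1, cross_anticomm p.1, sig_smul_left]
  simp

/-- `sig` as a real bilinear map. -/
def sigB : E3 →L[ℝ] Spinor →L[ℝ] Spinor :=
  LinearMap.toContinuousLinearMap
    { toFun := fun v => LinearMap.toContinuousLinearMap ((sig v).restrictScalars ℝ)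
      map_add' := fun u v => by ext s : 1; exact sig_add_left u v s
      map_smul' := fun c v => by ext s : 1; exact sig_smul_left c v s }

theorem sigB_apply (v : E3) (s : Spinor) : sigB v s = sig v s := rfl

theorem IsSmooth.sig {Y : S2 → E3} {ψ : S2 → Spinor} (hY : IsSmooth Y) (hψ : IsSmooth ψ) :
    IsSmooth (fun p => sig (Y p) (ψ p)) :=
  hY.bilin sigB hψ

theorem IsSmooth.chirality {ψ : S2 → Spinor} (hψ : IsSmooth ψ) : IsSmooth (chirality ψ) :=
  isSmooth_coe.sig hψ

theorem chirality_apply (ψ : S2 → Spinor) (p : S2) : chirality ψ p = sig p (ψ p) := rfl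

theorem dirDeriv_chirality {ψ : S2 → Spinor} (hψ : IsSmooth ψ) {p : S2} {v : E3}
    (hv : v ∈ tangent p) :
    dirDeriv (chirality ψ) p v = sig v (ψ p) + sig p (dirDeriv ψ p v) := by
  have h := dirDeriv_bilin sigB isSmooth_coe hψ hv
  rw [dirDeriv_coe hv] at h
  exact h

/-! ### The Dirac operator in terms of rotational derivatives -/

theorem sig_smul_real (v : E3) (c : ℝ) (s : Spinor) : sig v (c • s) = c • sig v s :=
  (sig v).map_smul_of_tower c s

theorem inner_coe_stdVec (p : S2) (k : Fin 3) : inner ℝ (p : E3) (stdVec k) = (p : E3) k := by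
  fin_cases k <;> simp [inner_eq_coord, stdVec]

theorem sum_smul_angDeriv (ψ : S2 → Spinor) (p : S2) :
    (p : E3) 0 • angDeriv (stdVec 0) ψ p + (p : E3) 1 • angDeriv (stdVec 1) ψ p
      + (p : E3) 2 • angDeriv (stdVec 2) ψ p = 0 := by
  simp only [angDeriv, ← dirDeriv_smul_vec, ← dirDeriv_add_vec]
  have : (p : E3) 0 • cross (stdVec 0) p + (p : E3) 1 • cross (stdVec 1) p
      + (p : E3) 2 • cross (stdVec 2) p = 0 := by
    ext i; fin_cases i <;> simp [stdVec] <;> ring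
  rw [this]
  exact map_zero _

/-- The zeroth-order term `iΓψ` comes from the connection term `½ v · p · ψ`. In the first-order
part, `σ(p)σ_k = p_k - iσ(e_k × p)` turns the trace over the Parseval frame `e_k × p` into `∑ σ_k
R_k`, since `∑ p_k R_k = 0`. -/
theorem dirac_eq (ψ : S2 → Spinor) (p : S2) :
    dirac ψ p = Complex.I • sig p (ψ p - Complex.I • ∑ k, sig (stdVec k)
      (angDeriv (stdVec k) ψ p)) := by
  let B : E3 →ₗ[ℝ] E3 →ₗ[ℝ] Spinor := LinearMap.mk₂ ℝ (fun u v => sig u (dirDeriv ψ p v))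
    (fun u v w => sig_add_left _ _ _) (fun c u v => sig_smul_left _ _ _)
    (fun u v w => by rw [dirDeriv_add_vec, map_add])
    (fun c u v => by rw [dirDeriv_smul_vec, sig_smul_real])
  have hB : ∀ u v, B u v = sig u (dirDeriv ψ p v) := fun u v => rfl
  let C : E3 →ₗ[ℝ] E3 →ₗ[ℝ] Spinor := LinearMap.mk₂ ℝ (fun u v => sig u (sig v (sig p (ψ p))))
    (fun u v w => sig_add_left _ _ _) (fun c u v => sig_smul_left _ _ _)
    (fun u v w => by rw [sig_add_left, map_add])
    (fun c u v => by rw [sig_smul_left, sig_smul_real])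
  have hC : ∀ u v, C u v = sig u (sig v (sig p (ψ p))) := fun u v => rfl
  have hstd : ∀ k : Fin 3, ∀ s, sig (stdVec k) (sig (stdVec k) s) = s := fun k s =>
    sig_coe_sig_coe ⟨stdVec k, by simp [stdVec]⟩ s
  have h1 : dirac ψ p = ∑ i, (-Complex.I • B (frame p i) (frame p i)
      + (Complex.I / 2) • C (frame p i) (frame p i)) := by
    refine Finset.sum_congr rfl fun i _ => ?_
    simp only [spinDeriv, cliff_apply, map_add, map_smul, hB, hC]
    match_scalars
    · ring
    · linear_combination (-(1 / 2 : ℂ) * Complex.I) * Complex.I_sq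
  rw [h1, Finset.sum_add_distrib, ← Finset.smul_sum, ← Finset.smul_sum, sum_frame, sum_frame]
  simp only [hC, hstd, sig_coe_sig_coe]
  rw [← sum_cross]
  have h2 : ∀ k : Fin 3, sig p (sig (stdVec k) (angDeriv (stdVec k) ψ p))
      = ((p : E3) k) • angDeriv (stdVec k) ψ p
        - Complex.I • B (cross (stdVec k) p) (cross (stdVec k) p) := by
    intro k
    rw [sig_sig, cross_anticomm, inner_coe_stdVec, sig_smul_left, hB, angDeriv]
    simp [sub_eq_add_neg]
  have h5 := sum_smul_angDeriv ψ p
  simp only [Fin.sum_univ_three, map_sub, map_smul, map_add, h2]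
  obtain ⟨T, hT⟩ : ∃ T, T = B (cross (stdVec 0) p) (cross (stdVec 0) p)
    + B (cross (stdVec 1) p) (cross (stdVec 1) p)
    + B (cross (stdVec 2) p) (cross (stdVec 2) p) := ⟨_, rfl⟩
  have h6 : ((p : E3) 0 • angDeriv (stdVec 0) ψ p
        - Complex.I • B (cross (stdVec 0) p) (cross (stdVec 0) p))
      + ((p : E3) 1 • angDeriv (stdVec 1) ψ p
        - Complex.I • B (cross (stdVec 1) p) (cross (stdVec 1) p))
      + ((p : E3) 2 • angDeriv (stdVec 2) ψ p
        - Complex.I • B (cross (stdVec 2) p) (cross (stdVec 2) p)) = -Complex.I • T := by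
    rw [← sub_eq_zero, ← h5, hT]
    module
  rw [h6, ← hT]
  match_scalars
  · linear_combination (-Complex.I) * Complex.I_sq
  · ring

theorem dirac_chirality {ψ : S2 → Spinor} (hψ : IsSmooth ψ) :
    dirac (chirality ψ) = -chirality (dirac ψ) := by
  funext p
  have h1 : ∀ k : Fin 3, sig (stdVec k) (angDeriv (stdVec k) (chirality ψ) p)
      = sig (stdVec k) (sig (cross (stdVec k) p) (ψ p))
        + ((2 * (p : E3) k) • angDeriv (stdVec k) ψ p
          - sig p (sig (stdVec k) (angDeriv (stdVec k) ψ p))) := by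
    intro k
    rw [angDeriv, dirDeriv_chirality hψ (cross_mem_tangent _ p), map_add, ← angDeriv]
    rw [sig_sig _ p.1, sig_sig p.1, real_inner_comm p.1, inner_coe_stdVec,
      cross_anticomm p.1, sig_smul_left]
    congr 1
    rw [two_mul, add_smul]
    simp
  have h5 := sum_smul_angDeriv ψ p
  have h6 : sig (stdVec 0) (sig (cross (stdVec 0) p) (ψ p))
      + sig (stdVec 1) (sig (cross (stdVec 1) p) (ψ p))
      + sig (stdVec 2) (sig (cross (stdVec 2) p) (ψ p)) = (-2 * Complex.I) • sig p (ψ p) := by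
    have h7 : ∀ k : Fin 3, inner ℝ (stdVec k) (cross (stdVec k) p) = 0 := fun k => by
      rw [inner_eq_coord]; simp; ring
    have h8 : cross (stdVec 0) (cross (stdVec 0) p) + cross (stdVec 1) (cross (stdVec 1) p)
        + cross (stdVec 2) (cross (stdVec 2) p) = (-2 : ℝ) • (p : E3) := by
      ext i; fin_cases i <;> simp [stdVec] <;> ring
    simp only [sig_sig, h7, Complex.ofReal_zero, zero_smul, zero_add, ← smul_add,
      ← sig_add_left, h8]
    rw [sig_smul_left, mul_comm, mul_smul]
    module
  obtain ⟨S, hS⟩ : ∃ S, S = sig (stdVec 0) (angDeriv (stdVec 0) ψ p)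
    + sig (stdVec 1) (angDeriv (stdVec 1) ψ p) + sig (stdVec 2) (angDeriv (stdVec 2) ψ p) :=
    ⟨_, rfl⟩
  have h9 : ∑ k, sig (stdVec k) (angDeriv (stdVec k) (chirality ψ) p)
      = (-2 * Complex.I) • sig p (ψ p) - sig p S := by
    rw [Fin.sum_univ_three, h1, h1, h1, ← h6, hS, map_add, map_add]
    linear_combination (norm := module) (2 : ℝ) • h5
  rw [Pi.neg_apply, chirality_apply, dirac_eq, dirac_eq, h9, Fin.sum_univ_three, ← hS,
    chirality_apply]
  simp only [map_sub, map_smul, sig_coe_sig_coe]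
  match_scalars
  · linear_combination (2 * Complex.I) * Complex.I_sq
  · ring

/-! ### The Kosmann-Lichnerowicz derivative -/

theorem sum_inner_smul_sig_frame (p : S2) (w : E3) (s : Spinor) :
    ∑ i, inner ℝ (frame p i : E3) w • sig (frame p i) s
      = sig ((tangent p).starProjection w) s := by
  rw [starProjection_tangent, ← sum_inner_frame]
  have h := map_sum (sigB.flip s) (fun i => inner ℝ (frame p i : E3) w • (frame p i : E3))
    Finset.univ
  simp only [ContinuousLinearMap.flip_apply, sigB_apply, sig_smul_left] at h
  exact h.symm

theorem sig_comm (u v : E3) (s : Spinor) :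
    sig u (sig v s) - sig v (sig u s) = (2 * Complex.I) • sig (cross u v) s := by
  rw [sig_sig, sig_sig, real_inner_comm v u, cross_anticomm v u, sig_smul_left]
  module

/-- The antisymmetric part of `∇X` on a plane is one number, the normal component of the curl. -/
theorem sum_cross_frame {X : S2 → E3} (hX : IsSmooth X) (p : S2) :
    ∑ i, cross (frame p i) ((tangent p).starProjection (dirDeriv X p (frame p i)))
      = curl X p • (p : E3) := by
  let A : E3 →L[ℝ] E3 := fderiv ℝ (radialExt X) p
  have hA : ∀ v, dirDeriv X p v = A v := fun v => rfl
  -- The radial extension has no derivative along `p`, which removes the normal term left by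
  -- `sum_frame`.
  have hAp : A p = 0 := hX.dirDeriv_self p
  let B : E3 →ₗ[ℝ] E3 →ₗ[ℝ] E3 := LinearMap.mk₂ ℝ
    (fun u v => crossB u ((tangent p).starProjection (A v)))
    (fun u v w => by rw [map_add, _root_.add_apply])
    (fun c u v => by rw [map_smul, _root_.smul_apply])
    (fun u v w => by rw [map_add, map_add, map_add]) (fun c u v => by
      rw [map_smul, map_smul, map_smul])
  have hB : ∀ u v, B u v = cross u ((tangent p).starProjection (A v)) := fun u v => rfl
  have h1 := sum_frame p B
  simp only [hB] at h1
  simp only [hA]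
  rw [h1, hAp]
  have e : ∀ v : E3, A v = v 0 • A (stdVec 0) + v 1 • A (stdVec 1) + v 2 • A (stdVec 2) := by
    intro v
    conv_lhs => rw [eq_sum_stdVec v]
    simp only [map_add, map_smul]
  have hc : curl X p = A (cross (stdVec 0) p) 0 + A (cross (stdVec 1) p) 1
      + A (cross (stdVec 2) p) 2 := by
    simp only [curl, Fin.sum_univ_three, angDeriv, hA]
  rw [e] at hAp
  rw [hc, e (cross (stdVec 0) p), e (cross (stdVec 1) p), e (cross (stdVec 2) p)]
  have h := fun j : Fin 3 => congrArg (fun v : E3 => v j) hAp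
  have h0 := h 0
  have h1 := h 1
  have h2 := h 2
  have hs := sum_sq_coe p
  simp only [PiLp.add_apply, PiLp.smul_apply, smul_eq_mul, PiLp.zero_apply] at h0 h1 h2
  simp only [starProjection_tangent, inner_eq_coord]
  generalize A (stdVec 0) = a at *
  generalize A (stdVec 1) = b at *
  generalize A (stdVec 2) = c at *
  ext i
  fin_cases i
  · simp [stdVec]
    linear_combination (p : E3) 1 * h2 - (p : E3) 2 * h1 - (b 2 - c 1) * hs
  · simp [stdVec]
    linear_combination (p : E3) 2 * h0 - (p : E3) 0 * h2 - (c 0 - a 2) * hs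
  · simp [stdVec]
    linear_combination (p : E3) 0 * h1 - (p : E3) 1 * h0 - (a 1 - b 0) * hs

/-- The double sum in the definition sees only the commutators `[σ(u), σ(v)] = 2iσ(u × v)`, hence
only the curl: it equals `-2i (curl X) Γψ`. The middle term is the spin connection. -/
theorem kosmann_eq {X : S2 → E3} (hX : IsSmooth X) (ψ : S2 → Spinor) (p : S2) :
    kosmann X ψ p = dirDeriv ψ p (X p) - (1 / 2 : ℂ) • sig (X p) (sig p (ψ p))
      + (Complex.I / 4 * (curl X p : ℂ)) • sig p (ψ p) := by
  have h1 : ∀ i j, ((inner ℝ (covDeriv X p (frame p i)) (frame p j : E3)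
      - inner ℝ (covDeriv X p (frame p j)) (frame p i : E3) : ℝ) : ℂ) •
        cliff (frame p i) (cliff (frame p j) (ψ p))
      = sig (frame p i) (-(inner ℝ (frame p j : E3) (dirDeriv X p (frame p i))
          • sig (frame p j) (ψ p)))
        + inner ℝ (frame p i : E3) (dirDeriv X p (frame p j))
          • sig (frame p i) (sig (frame p j) (ψ p)) := by
    intro i j
    rw [inner_covDeriv _ _ _ (frame p j).2, inner_covDeriv _ _ _ (frame p i).2, real_inner_comm,
      real_inner_comm (frame p i : E3), map_neg, sig_smul_real]
    simp only [cliff_apply, map_smul]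
    match_scalars
    simp
    ring
  have h2 : ∑ i, ∑ j, ((inner ℝ (covDeriv X p (frame p i)) (frame p j : E3)
      - inner ℝ (covDeriv X p (frame p j)) (frame p i : E3) : ℝ) : ℂ) •
        cliff (frame p i) (cliff (frame p j) (ψ p))
      = (-2 * Complex.I * curl X p) • sig p (ψ p) := by
    simp only [h1, Finset.sum_add_distrib]
    rw [Finset.sum_comm (f := fun i j => inner ℝ (frame p i : E3) (dirDeriv X p (frame p j))
          • sig (frame p i) (sig (frame p j) (ψ p)))]
    simp only [← map_sum, sum_inner_smul_sig_frame, Finset.sum_neg_distrib]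
    rw [← Finset.sum_add_distrib]
    have h3 : ∀ i, sig (frame p i) (-sig ((tangent p).starProjection
          (dirDeriv X p (frame p i))) (ψ p))
        + sig ((tangent p).starProjection (dirDeriv X p (frame p i))) (sig (frame p i) (ψ p))
        = (-2 * Complex.I) • sigB.flip (ψ p) (cross (frame p i) ((tangent p).starProjection
          (dirDeriv X p (frame p i)))) := by
      intro i
      have := sig_comm (frame p i) ((tangent p).starProjection (dirDeriv X p (frame p i))) (ψ p)
      rw [ContinuousLinearMap.flip_apply, sigB_apply, map_neg]
      linear_combination (norm := module) (-1 : ℂ) • this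
    simp only [h3]
    rw [← Finset.smul_sum, ← map_sum, sum_cross_frame hX, ContinuousLinearMap.flip_apply,
      sigB_apply, sig_smul_left]
    match_scalars
    simp
  rw [kosmann, h2, spinDeriv]
  simp only [cliff_apply, map_smul]
  match_scalars
  · ring
  · linear_combination (1 / 2 : ℂ) * Complex.I_sq
  · ring

/-! ### Chiral matrix elements -/

theorem kosmann_smul {X : S2 → E3} (hX : IsSmooth X) (hT : ∀ p, X p ∈ tangent p) (c : ℂ)
    {ψ : S2 → Spinor} (hψ : IsSmooth ψ) : kosmann X (c • ψ) = c • kosmann X ψ := by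
  funext p
  have h := dirDeriv_clm_comp
    ((LinearMap.toContinuousLinearMap (c • LinearMap.id : Spinor →ₗ[ℂ] Spinor)).restrictScalars ℝ)
    hψ (hT p)
  have h' : dirDeriv (c • ψ) p (X p) = c • dirDeriv ψ p (X p) := h
  rw [Pi.smul_apply, kosmann_eq hX, kosmann_eq hX, h', Pi.smul_apply, map_smul, map_smul]
  module

theorem kosmann_add {X : S2 → E3} (hX : IsSmooth X) (hT : ∀ p, X p ∈ tangent p)
    {φ ψ : S2 → Spinor} (hφ : IsSmooth φ) (hψ : IsSmooth ψ) :
    kosmann X (φ + ψ) = kosmann X φ + kosmann X ψ := by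
  funext p
  have h' : dirDeriv (φ + ψ) p (X p) = dirDeriv φ p (X p) + dirDeriv ψ p (X p) :=
    IsSmooth.dirDeriv_eq (ContMDiff.add hφ hψ) (hT p)
      ((hφ.hasDerivAt_curve (hT p)).add (hψ.hasDerivAt_curve (hT p)))
  rw [Pi.add_apply, kosmann_eq hX, kosmann_eq hX, kosmann_eq hX, h', Pi.add_apply, map_add, map_add]
  module

/-- The derivative of `Γ` along `X` is `σ(X)`, and the connection term cancels it because `σ(X)`
anticommutes with `σ(p)` for tangent `X`. -/
theorem kosmann_chirality {X : S2 → E3} (hX : IsSmooth X) (hT : ∀ p, X p ∈ tangent p)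
    {ψ : S2 → Spinor} (hψ : IsSmooth ψ) :
    kosmann X (chirality ψ) = chirality (kosmann X ψ) := by
  funext p
  rw [chirality_apply, kosmann_eq hX, kosmann_eq hX, chirality_apply,
    dirDeriv_chirality hψ (hT p), sig_coe_sig_coe]
  simp only [map_add, map_sub, map_smul, sig_anticomm (hT p), sig_coe_sig_coe]
  module

theorem IsSmooth.smul_complex {ψ : S2 → Spinor} (hψ : IsSmooth ψ) (c : ℂ) : IsSmooth (c • ψ) :=
  (contDiff_const_smul (𝕜 := ℝ) (n := ∞) c).comp_isSmooth hψ

theorem chirality_chirality (ψ : S2 → Spinor) : chirality (chirality ψ) = ψ :=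
  funext fun p => sig_coe_sig_coe p _

theorem plusPart_add_I_smul (ψ : S2 → Spinor) :
    plusPart (ψ + Complex.I • chirality ψ) = ((1 + Complex.I) / 2) • (ψ + chirality ψ) := by
  rw [plusPart, chirality_add, chirality_smul, chirality_chirality]
  module

theorem minusPart_add_I_smul (ψ : S2 → Spinor) :
    minusPart (ψ + Complex.I • chirality ψ)
      = ((1 - Complex.I) / 2) • (ψ + (-1 : ℂ) • chirality ψ) := by
  rw [minusPart, chirality_add, chirality_smul, chirality_chirality]
  module

/-- The positive part of `ψ + iΓψ` is `(1 + i)/2` times `ψ + Γψ`. The squared modulus `1/2` of the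
scalar cancels the `2` obtained by expanding the pairing, as `Γ` is symmetric and commutes with the
derivative. The negative part differs only in the sign of the `Γ` term. -/
theorem inner_plusPart_kosmann {X : S2 → E3} (hX : IsSmooth X) (hT : ∀ p, X p ∈ tangent p)
    (φ : S2 → Spinor) {ψ : S2 → Spinor} (hψ : IsSmooth ψ) (p : S2) :
    inner ℂ (plusPart (φ + Complex.I • chirality φ) p)
        (kosmann X (plusPart (ψ + Complex.I • chirality ψ)) p)
      = inner ℂ (φ p) (kosmann X ψ p) + inner ℂ (φ p) (sig p (kosmann X ψ p)) := by
  rw [plusPart_add_I_smul, plusPart_add_I_smul,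
    kosmann_smul hX hT _ (ContMDiff.add hψ hψ.chirality), kosmann_add hX hT hψ hψ.chirality,
    kosmann_chirality hX hT hψ]
  simp only [Pi.smul_apply, Pi.add_apply, chirality_apply, inner_smul_left, inner_smul_right,
    inner_add_left, inner_add_right, inner_sig, sig_coe_sig_coe]
  simp
  rw [show (starRingEnd ℂ) 2 = 2 from map_ofNat _ 2]
  linear_combination (-(1 / 2 : ℂ) * (inner ℂ (φ p) (kosmann X ψ p)
    + inner ℂ (φ p) (sig p (kosmann X ψ p)))) * Complex.I_sq

theorem inner_minusPart_kosmann {X : S2 → E3} (hX : IsSmooth X) (hT : ∀ p, X p ∈ tangent p)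
    (φ : S2 → Spinor) {ψ : S2 → Spinor} (hψ : IsSmooth ψ) (p : S2) :
    inner ℂ (minusPart (φ + Complex.I • chirality φ) p)
        (kosmann X (minusPart (ψ + Complex.I • chirality ψ)) p)
      = inner ℂ (φ p) (kosmann X ψ p) - inner ℂ (φ p) (sig p (kosmann X ψ p)) := by
  have h1 := hψ.chirality.smul_complex (-1)
  rw [minusPart_add_I_smul, minusPart_add_I_smul,
    kosmann_smul hX hT _ (ContMDiff.add hψ h1), kosmann_add hX hT hψ h1,
    kosmann_smul hX hT _ hψ.chirality, kosmann_chirality hX hT hψ]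
  simp only [Pi.smul_apply, Pi.add_apply, chirality_apply, inner_smul_left, inner_smul_right,
    inner_add_left, inner_add_right, inner_sig, sig_coe_sig_coe]
  simp
  rw [show (starRingEnd ℂ) 2 = 2 from map_ofNat _ 2]
  linear_combination (-(1 / 2 : ℂ) * (inner ℂ (φ p) (kosmann X ψ p)
    - inner ℂ (φ p) (sig p (kosmann X ψ p)))) * Complex.I_sq

theorem kosmann_const {X : S2 → E3} (hX : IsSmooth X) (hT : ∀ p, X p ∈ tangent p) (χ : Spinor)
    (p : S2) : kosmann X (fun _ => χ) p = -(1 / 2 : ℂ) • sig (X p) (sig p χ)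
      + (Complex.I / 4 * (curl X p : ℂ)) • sig p χ := by
  rw [kosmann_eq hX, dirDeriv_const χ (hT p)]
  module

theorem sig_kosmann_const {X : S2 → E3} (hX : IsSmooth X) (hT : ∀ p, X p ∈ tangent p) (χ : Spinor)
    (p : S2) : sig p (kosmann X (fun _ => χ) p) = (1 / 2 : ℂ) • sig (X p) χ
      + (Complex.I / 4 * (curl X p : ℂ)) • χ := by
  rw [kosmann_const hX hT]
  simp only [map_add, map_smul, sig_anticomm (hT p), sig_coe_sig_coe]
  module

/-! ### Eigenspinors from spherical harmonics -/

/-- The spinor `(l + 1) g χ - i ∑ₖ (R_k g) σ_k χ`. -/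
def harmSpinor (l : ℕ) (g : Poly) (χ : Spinor) (p : S2) : Spinor :=
  evalS g p • (((l : ℝ) + 1) • χ) + evalS (rotP 0 g) p • (-Complex.I • sig (stdVec 0) χ)
    + evalS (rotP 1 g) p • (-Complex.I • sig (stdVec 1) χ)
    + evalS (rotP 2 g) p • (-Complex.I • sig (stdVec 2) χ)

theorem isSmooth_evalS_smul (g : Poly) (χ : Spinor) : IsSmooth (fun p => evalS g p • χ) :=
  (contDiff_id.smul contDiff_const).comp_isSmooth (isSmooth_evalS g)

theorem angDeriv_evalS_smul (k : Fin 3) (g : Poly) (χ : Spinor) (p : S2) :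
    angDeriv (stdVec k) (fun p => evalS g p • χ) p = evalS (rotP k g) p • χ := by
  have h := dirDeriv_clm_comp (ContinuousLinearMap.toSpanSingleton ℝ χ) (isSmooth_evalS g)
    (cross_mem_tangent (stdVec k) p)
  have h2 := congrFun (angDeriv_evalS k g) p
  rw [angDeriv] at h2
  rw [h2] at h
  exact h

theorem dirDeriv_add {F : Type*} [NormedAddCommGroup F] [NormedSpace ℝ F] {f g : S2 → F}
    (hf : IsSmooth f) (hg : IsSmooth g) {p : S2} {v : E3} (hv : v ∈ tangent p) :
    dirDeriv (fun q => f q + g q) p v = dirDeriv f p v + dirDeriv g p v :=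
  IsSmooth.dirDeriv_eq (ContMDiff.add hf hg) hv
    ((hf.hasDerivAt_curve hv).add (hg.hasDerivAt_curve hv))

theorem isSmooth_harmSpinor (l : ℕ) (g : Poly) (χ : Spinor) : IsSmooth (harmSpinor l g χ) :=
  ContMDiff.add (ContMDiff.add (ContMDiff.add (isSmooth_evalS_smul _ _) (isSmooth_evalS_smul _ _))
    (isSmooth_evalS_smul _ _)) (isSmooth_evalS_smul _ _)

theorem angDeriv_harmSpinor (k : Fin 3) (l : ℕ) (g : Poly) (χ : Spinor) (p : S2) :
    angDeriv (stdVec k) (harmSpinor l g χ) p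
      = evalS (rotP k g) p • (((l : ℝ) + 1) • χ)
        + evalS (rotP k (rotP 0 g)) p • (-Complex.I • sig (stdVec 0) χ)
        + evalS (rotP k (rotP 1 g)) p • (-Complex.I • sig (stdVec 1) χ)
        + evalS (rotP k (rotP 2 g)) p • (-Complex.I • sig (stdVec 2) χ) := by
  have hv := cross_mem_tangent (stdVec k) p
  have hs := isSmooth_evalS_smul
  have h1 := dirDeriv_add (ContMDiff.add (ContMDiff.add (hs g (((l : ℝ) + 1) • χ))
    (hs (rotP 0 g) (-Complex.I • sig (stdVec 0) χ)))
    (hs (rotP 1 g) (-Complex.I • sig (stdVec 1) χ)))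
    (hs (rotP 2 g) (-Complex.I • sig (stdVec 2) χ)) hv
  have h2 := dirDeriv_add (ContMDiff.add (hs g (((l : ℝ) + 1) • χ))
    (hs (rotP 0 g) (-Complex.I • sig (stdVec 0) χ)))
    (hs (rotP 1 g) (-Complex.I • sig (stdVec 1) χ)) hv
  have h3 := dirDeriv_add (hs g (((l : ℝ) + 1) • χ))
    (hs (rotP 0 g) (-Complex.I • sig (stdVec 0) χ)) hv
  rw [← angDeriv_evalS_smul, ← angDeriv_evalS_smul, ← angDeriv_evalS_smul, ← angDeriv_evalS_smul]
  exact h1.trans (congrArg (· + _) (h2.trans (congrArg (· + _) h3)))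

/-- With `L = -iR`, the spinor is `(l + 1 + σ·L)(gχ)`. From `(σ·L)² = L² - σ·L` and `L² = l(l + 1)`
follows `(σ·L - l)(σ·L + l + 1) = 0`, so `1 + σ·L` acts on it as `l + 1`. -/
theorem dirac_harmSpinor {l : ℕ} {g : Poly} (hg : IsHarm l g) (χ : Spinor) :
    dirac (harmSpinor l g χ) = ((l + 1 : ℝ) : ℂ) • Complex.I • chirality (harmSpinor l g χ) := by
  funext p
  rw [dirac_eq]
  have c0 := congrArg (fun q => evalS q p) (rotP_comm_zero_one g)
  have c1 := congrArg (fun q => evalS q p) (rotP_comm_one_two g)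
  have c2 := congrArg (fun q => evalS q p) (rotP_comm_two_zero g)
  have hL := congrArg (fun q => evalS q p) hg.2
  have hneg : ∀ q, evalS (-q) p = -evalS q p := fun q => by simp [evalS]
  simp only [evalS_sub, hneg, lapS_apply, evalS_add, evalS_smul] at c0 c1 c2 hL
  -- The commutation relations bring second derivatives to a fixed order, and harmonicity eliminates
  -- `R_0² g`; the remaining values are independent.
  have e0 : evalS (rotP 0 (rotP 1 g)) p = evalS (rotP 1 (rotP 0 g)) p - evalS (rotP 2 g) p := by
    linear_combination c0
  have e1 : evalS (rotP 1 (rotP 2 g)) p = evalS (rotP 2 (rotP 1 g)) p - evalS (rotP 0 g) p := by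
    linear_combination c1
  have e2 : evalS (rotP 2 (rotP 0 g)) p = evalS (rotP 0 (rotP 2 g)) p - evalS (rotP 1 g) p := by
    linear_combination c2
  have e3 : evalS (rotP 0 (rotP 0 g)) p = -evalS (rotP 1 (rotP 1 g)) p
      - evalS (rotP 2 (rotP 2 g)) p - (l * (l + 1)) * evalS g p := by
    linear_combination hL
  have h : harmSpinor l g χ p - Complex.I • ∑ k, sig (stdVec k)
      (angDeriv (stdVec k) (harmSpinor l g χ) p) = ((l + 1 : ℝ) : ℂ) • harmSpinor l g χ p := by
    simp only [Fin.sum_univ_three, angDeriv_harmSpinor, harmSpinor, e0, e1, e2, e3]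
    apply spinor_ext <;>
    · simp [sig_apply_zero, sig_apply_one, stdVec]
      ring_nf
      simp only [Complex.I_sq, Complex.I_pow_three, Complex.I_pow_four]
      ring
  rw [h, map_smul, smul_comm]
  rfl

/-- From `D b = m iΓb` and `DΓ = -ΓD` one gets `D(b + iΓb) = m iΓb + m b`, with `m = l + 1 > 0`. -/
theorem harmSpinor_mem_positiveSpace {l : ℕ} {g : Poly} (hg : IsHarm l g) (χ : Spinor) :
    harmSpinor l g χ + Complex.I • chirality (harmSpinor l g χ) ∈ positiveSpace := by
  have hs := isSmooth_harmSpinor l g χ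
  have hs' := hs.chirality.smul_complex Complex.I
  refine Submodule.mem_iSup_of_mem ((l : ℝ) + 1) (Submodule.mem_iSup_of_mem (by positivity)
    ⟨ContMDiff.add hs hs', ?_⟩)
  rw [dirac_add hs hs', dirac_smul _ hs.chirality, dirac_chirality hs, dirac_harmSpinor hg,
    chirality_smul, chirality_smul, chirality_chirality]
  match_scalars
  · ring
  · linear_combination (-((l : ℂ) + 1)) * Complex.I_sq

theorem harmSpinor_one (χ : Spinor) : harmSpinor 0 (MvPolynomial.C 1) χ = fun _ => χ := by
  funext p
  simp [harmSpinor, evalS]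

theorem isHarm_one : IsHarm 0 (MvPolynomial.C 1) :=
  ⟨MvPolynomial.isHomogeneous_C _ _, by rw [lapS_C]; simp⟩

/-! ### Strong chiral symmetry tested on the explicit eigenspinors -/

theorem continuous_curl {X : S2 → E3} (hX : IsSmooth X) : Continuous (curl X) :=
  continuous_finsetSum _ fun k _ => ((hX.angDeriv (stdVec k)).coord k).continuous

/-- Pairing the degree-`l` eigenspinor with the eigenvalue-one spinor built from `χ`, the equality
of the two chiral matrix elements says that their difference `2⟨b, Γ𝓛_X χ⟩` vanishes. -/
theorem integral_inner_harmSpinor {X : S2 → E3} (hX : IsSmooth X) (hT : ∀ p, X p ∈ tangent p)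
    (h : HasStrongChiralSymmetry X) {l : ℕ} {g : Poly} (hg : IsHarm l g) (χ : Spinor) :
    Integrable (fun p => inner ℂ (harmSpinor l g χ p) ((1 / 2 : ℂ) • sig (X p) χ
      + (Complex.I / 4 * (curl X p : ℂ)) • χ)) area ∧
    ∫ p, inner ℂ (harmSpinor l g χ p) ((1 / 2 : ℂ) • sig (X p) χ
      + (Complex.I / 4 * (curl X p : ℂ)) • χ) ∂area = 0 := by
  have h1 := h.matrix_eq _ (harmSpinor_mem_positiveSpace hg χ) _
    (harmSpinor_mem_positiveSpace isHarm_one χ)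
  have hχ := isSmooth_const χ
  rw [harmSpinor_one] at h1
  simp only [l2inner, inner_plusPart_kosmann hX hT _ hχ, inner_minusPart_kosmann hX hT _ hχ] at h1
  have cb := (isSmooth_harmSpinor l g χ).continuous
  have cc := continuous_curl hX
  have c1 : Continuous fun p : S2 => sig p χ := (isSmooth_coe.sig hχ).continuous
  have c2 : Continuous fun p : S2 => sig (X p) (sig p χ) :=
    (hX.sig (isSmooth_coe.sig hχ)).continuous
  have c3 : Continuous fun p : S2 => sig (X p) χ := (hX.sig hχ).continuous
  have i1 : Integrable (fun p => inner ℂ (harmSpinor l g χ p) (kosmann X (fun _ => χ) p)) area := by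
    simp only [kosmann_const hX hT]
    exact Continuous.integrable_area (by fun_prop)
  have i2 : Integrable (fun p => inner ℂ (harmSpinor l g χ p) ((1 / 2 : ℂ) • sig (X p) χ
      + (Complex.I / 4 * (curl X p : ℂ)) • χ)) area := Continuous.integrable_area (by fun_prop)
  refine ⟨i2, ?_⟩
  simp only [sig_kosmann_const hX hT] at h1
  rw [integral_add i1 i2, integral_sub i1 i2] at h1
  linear_combination (1 / 2 : ℂ) * h1

/-- Summing over the standard basis of `ℂ²` takes a trace: `tr σ_j = 0` and `tr σ_j σ_k = 2δ_jk`
eliminate the cross terms. -/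
theorem sum_inner_harmSpinor {X : S2 → E3} (l : ℕ) (g : Poly) (p : S2) (c : ℝ) :
    inner ℂ (harmSpinor l g (EuclideanSpace.single 0 1) p)
        ((1 / 2 : ℂ) • sig (X p) (EuclideanSpace.single 0 1)
          + (Complex.I / 4 * (c : ℂ)) • EuclideanSpace.single 0 1)
      + inner ℂ (harmSpinor l g (EuclideanSpace.single 1 1) p)
        ((1 / 2 : ℂ) • sig (X p) (EuclideanSpace.single 1 1)
          + (Complex.I / 4 * (c : ℂ)) • EuclideanSpace.single 1 1)
      = Complex.I / 2 * (((l + 1) * (c * evalS g p)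
          + 2 * ∑ k, X p k * evalS (rotP k g) p : ℝ) : ℂ) := by
  rw [inner_spinor, inner_spinor, Fin.sum_univ_three]
  simp [harmSpinor, sig_apply_zero, sig_apply_one, stdVec]
  ring

/-- Strong chiral symmetry forces orthogonality to the rotated gradients of the spherical
harmonics of degree at least two. -/
theorem integral_eq_zero_of_hasStrongChiralSymmetry {X : S2 → E3} (hX : IsSmooth X)
    (hT : ∀ p, X p ∈ tangent p) (h : HasStrongChiralSymmetry X) {l : ℕ} (hl : 2 ≤ l) {g : Poly}
    (hg : IsHarm l g) : ∫ p, ∑ k, X p k * evalS (rotP k g) p ∂area = 0 := by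
  obtain ⟨i0, h0⟩ := integral_inner_harmSpinor hX hT h hg (EuclideanSpace.single 0 1)
  obtain ⟨i1, h1⟩ := integral_inner_harmSpinor hX hT h hg (EuclideanSpace.single 1 1)
  have h2 := integral_add i0 i1
  simp only [sum_inner_harmSpinor] at h2
  rw [h0, h1, integral_const_mul, integral_complex_ofReal] at h2
  have h3 : ∫ p, ((l + 1) * (curl X p * evalS g p) + 2 * ∑ k, X p k * evalS (rotP k g) p) ∂area
      = 0 := by
    have := (mul_eq_zero.mp (h2.trans (add_zero 0))).resolve_left (by simp)
    exact_mod_cast this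
  have j1 : Integrable (fun p => curl X p * evalS g p) area :=
    Continuous.integrable_area ((continuous_curl hX).mul (isSmooth_evalS g).continuous)
  rw [integral_add (j1.const_mul _) ((integrable_sum_mul_evalS_rotP hX g).const_mul 2),
    integral_const_mul, integral_const_mul, integral_curl_mul hX (isSmooth_evalS g)] at h3
  simp only [angDeriv_evalS] at h3
  have hl' : (2 : ℝ) ≤ l := by exact_mod_cast hl
  -- The curl contributes `-(l + 1)` after integration by parts, against the direct term `2`; the
  -- sum `1 - l` is nonzero for `l ≥ 2`.
  have h4 : (1 - (l : ℝ)) * ∫ p, ∑ k, X p k * evalS (rotP k g) p ∂area = 0 := by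
    linear_combination h3
  exact (mul_eq_zero.mp h4).resolve_left (by linarith)

theorem DivFreeField.isKilling_of_hasStrongChiralSymmetry (X : DivFreeField)
    (h : HasStrongChiralSymmetry X.toFun) : IsKilling X.toFun :=
  isKilling_of_orthogonal X.smooth' X.tangent' X.divFree' fun _ hl _ hg =>
    integral_eq_zero_of_hasStrongChiralSymmetry X.smooth' X.tangent' h hl hg

/-! ### Non-Killing fields are open and dense -/

/-- A first derivative at one point is a continuous function of the order-one component of the
topology. -/
theorem continuous_dirDeriv_toFun (p : S2) (u : E3) :
    Continuous fun X : DivFreeField => dirDeriv X.toFun p u := by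
  have h1 : Continuous fun X : DivFreeField => fun k : ℕ =>
      UniformFun.ofFun (fun p : S2 => iteratedFDeriv ℝ k (radialExt X.toFun) (p : E3)) :=
    continuous_induced_dom
  have h2 := (UniformFun.uniformContinuous_eval _ p).continuous.comp ((continuous_apply 1).comp h1)
  have h3 := (ContinuousMultilinearMap.apply ℝ (fun _ : Fin 1 => E3) E3
    (fun _ => u)).continuous.comp h2
  refine h3.congr fun X => ?_
  exact iteratedFDeriv_one_apply (𝕜 := ℝ) (fun _ : Fin 1 => u)

theorem isClosed_isKilling : IsClosed {X : DivFreeField | IsKilling X.toFun} := by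
  simp only [IsKilling, Set.ofPred_forall]
  refine isClosed_iInter fun p => isClosed_iInter fun u => isClosed_iInter fun _ =>
    isClosed_iInter fun v => isClosed_iInter fun _ => isClosed_eq ?_ continuous_const
  have hu := (tangent p).starProjection.continuous.comp (continuous_dirDeriv_toFun p u)
  have hv := (tangent p).starProjection.continuous.comp (continuous_dirDeriv_toFun p v)
  exact (hu.inner continuous_const).add (continuous_const.inner hv)

theorem dirDeriv_add_smul {X Y : S2 → E3} (hX : IsSmooth X) (hY : IsSmooth Y) (t : ℝ) {p : S2}
    {v : E3} (hv : v ∈ tangent p) :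
    dirDeriv (fun q => X q + t • Y q) p v = dirDeriv X p v + t • dirDeriv Y p v := by
  have h := dirDeriv_clm_comp (t • ContinuousLinearMap.id ℝ E3) hY hv
  have hs : IsSmooth (fun q => t • Y q) := (contDiff_const_smul t).comp_isSmooth hY
  rw [dirDeriv_add hX hs hv]
  exact congrArg _ h

theorem covDeriv_add_smul {X Y : S2 → E3} (hX : IsSmooth X) (hY : IsSmooth Y) (t : ℝ) {p : S2}
    {v : E3} (hv : v ∈ tangent p) :
    covDeriv (fun q => X q + t • Y q) p v = covDeriv X p v + t • covDeriv Y p v := by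
  rw [covDeriv, dirDeriv_add_smul hX hY t hv, map_add, map_smul]
  rfl

/-- The field `X + t Y`. -/
def DivFreeField.addSMul (X Y : DivFreeField) (t : ℝ) : DivFreeField where
  toFun p := X.toFun p + t • Y.toFun p
  tangent' p := add_mem (X.tangent' p) (Submodule.smul_mem _ t (Y.tangent' p))
  smooth' := ContMDiff.add X.smooth' ((contDiff_const_smul t).comp_isSmooth Y.smooth')
  divFree' p := by
    have hX := X.divFree' p
    have hY := Y.divFree' p
    rw [divergence] at hX hY ⊢
    simp only [covDeriv_add_smul X.smooth' Y.smooth' t (frame p _).2, inner_add_left,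
      real_inner_smul_left, Finset.sum_add_distrib, ← Finset.mul_sum, hX, hY]
    simp

theorem iteratedFDeriv_addSMul (X Y : DivFreeField) (t : ℝ) (k : ℕ) (p : S2) :
    iteratedFDeriv ℝ k (radialExt (X.addSMul Y t).toFun) (p : E3)
      = iteratedFDeriv ℝ k (radialExt X.toFun) (p : E3)
        + t • iteratedFDeriv ℝ k (radialExt Y.toFun) (p : E3) := by
  have h : radialExt (X.addSMul Y t).toFun = radialExt X.toFun + t • radialExt Y.toFun := by
    ext1 x
    by_cases hx : x ≠ 0 <;> simp [radialExt, hx, DivFreeField.addSMul]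
  have hX : ContDiffAt ℝ k (radialExt X.toFun) (p : E3) :=
    (X.smooth'.contDiffAt_radialExt (coe_ne_zero p)).of_le (by exact_mod_cast le_top)
  have hY : ContDiffAt ℝ k (radialExt Y.toFun) (p : E3) :=
    (Y.smooth'.contDiffAt_radialExt (coe_ne_zero p)).of_le (by exact_mod_cast le_top)
  rw [h, iteratedFDeriv_add_apply hX
    (show ContDiffAt ℝ k (t • radialExt Y.toFun) (p : E3) from hY.const_smul t),
    iteratedFDeriv_const_smul_apply hY]

theorem continuous_iteratedFDeriv_radialExt {X : S2 → E3} (hX : IsSmooth X) (k : ℕ) :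
    Continuous fun p : S2 => iteratedFDeriv ℝ k (radialExt X) (p : E3) := by
  rw [continuous_iff_continuousAt]
  intro p
  have h : ContDiffAt ℝ 0 (iteratedFDeriv ℝ k (radialExt X)) (p : E3) :=
    (hX.contDiffAt_radialExt (coe_ne_zero p)).iteratedFDeriv_right (by
      rw [zero_add]; exact_mod_cast le_top)
  exact h.continuousAt.comp continuous_subtype_val.continuousAt

/-- On the compact sphere each iterated derivative of `Y` is bounded, so at every order the
perturbation is uniformly `O(t)`. -/
theorem tendsto_addSMul (X Y : DivFreeField) :
    Filter.Tendsto (fun t : ℝ => X.addSMul Y t) (nhds 0) (nhds X) := by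
  rw [nhds_induced, Filter.tendsto_comap_iff, tendsto_pi_nhds]
  intro k
  rw [UniformFun.tendsto_iff_tendstoUniformly, Metric.tendstoUniformly_iff]
  intro ε hε
  obtain ⟨C, hC⟩ := (isCompact_range
    (continuous_iteratedFDeriv_radialExt Y.smooth' k)).isBounded.exists_norm_le
  have hC0 : 0 ≤ C := (norm_nonneg _).trans
    (hC _ (Set.mem_range_self (⟨stdVec 0, by simp [stdVec]⟩)))
  have hδ : 0 < ε / (C + 1) := by positivity
  filter_upwards [Metric.ball_mem_nhds (0 : ℝ) hδ] with t ht p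
  rw [mem_ball_zero_iff, lt_div_iff₀ (by positivity)] at ht
  have h1 := iteratedFDeriv_addSMul X Y t k p
  change dist (iteratedFDeriv ℝ k (radialExt X.toFun) (p : E3))
    (iteratedFDeriv ℝ k (radialExt (X.addSMul Y t).toFun) (p : E3)) < ε
  rw [h1, dist_self_add_right, norm_smul]
  have h2 := hC _ (Set.mem_range_self p)
  have h3 := norm_nonneg t
  nlinarith [mul_le_mul_of_nonneg_left h2 h3]

/-- The field `z (p × E₃)`. -/
def shearMap (x : E3) : E3 := x 2 • cross x (stdVec 2)

theorem hasFDerivAt_shearMap (x : E3) : HasFDerivAt shearMap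
    (x 2 • crossB.flip (stdVec 2)
      + (EuclideanSpace.proj 2 : E3 →L[ℝ] ℝ).smulRight (cross x (stdVec 2))) x := by
  have h1 : HasFDerivAt (fun x : E3 => x 2) (EuclideanSpace.proj 2 : E3 →L[ℝ] ℝ) x :=
    (EuclideanSpace.proj 2 : E3 →L[ℝ] ℝ).hasFDerivAt
  exact h1.smul (crossB.flip (stdVec 2)).hasFDerivAt

theorem contDiff_shearMap : ContDiff ℝ ∞ shearMap :=
  (EuclideanSpace.proj 2 : E3 →L[ℝ] ℝ).contDiff.smul (crossB.flip (stdVec 2)).contDiff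

theorem dirDeriv_shearMap {p : S2} {v : E3} (hv : v ∈ tangent p) :
    dirDeriv (fun q : S2 => shearMap q) p v
      = (p : E3) 2 • cross v (stdVec 2) + v 2 • cross p (stdVec 2) := by
  rw [dirDeriv_restrict contDiff_shearMap hv, (hasFDerivAt_shearMap _).fderiv]
  rfl

/-- A divergence-free field that is not a Killing field. -/
def shearField : DivFreeField where
  toFun p := shearMap p
  tangent' p := by
    rw [mem_tangent_iff_coord]
    simp [shearMap, stdVec]
    ring
  smooth' := contDiff_shearMap.isSmooth_restrict
  divFree' p := by
    let B : E3 →ₗ[ℝ] E3 →ₗ[ℝ] ℝ := (innerₗ E3).compl₁₂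
      ((p : E3) 2 • crossB.flip (stdVec 2) + (EuclideanSpace.proj 2 : E3 →L[ℝ] ℝ).smulRight
        (cross p (stdVec 2))).toLinearMap LinearMap.id
    have hB : ∀ u v, B u v
        = inner ℝ ((p : E3) 2 • cross u (stdVec 2) + u 2 • cross p (stdVec 2)) v := fun _ _ => rfl
    have h : divergence (fun q : S2 => shearMap q) p = ∑ i, B (frame p i) (frame p i) :=
      Finset.sum_congr rfl fun i _ => by
        rw [inner_covDeriv _ _ _ (frame p i).2, dirDeriv_shearMap (frame p i).2, hB]
    rw [h, sum_frame]
    simp [hB, inner_eq_coord, stdVec]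
    ring

theorem not_isKilling_shearField : ¬ IsKilling shearField.toFun := by
  intro h
  have h0 : ‖stdVec 0‖ = 1 := by simp [stdVec]
  have h1 : stdVec 1 ∈ tangent ⟨stdVec 0, by simp [h0]⟩ := by
    rw [mem_tangent_iff_coord]; simp [stdVec]
  have h2 : stdVec 2 ∈ tangent ⟨stdVec 0, by simp [h0]⟩ := by
    rw [mem_tangent_iff_coord]; simp [stdVec]
  -- At `p = E₁` the shear derivative along `E₃` is `E₁ × E₃ = -E₂`, and along `E₂` it is zero; the
  -- symmetrized derivative on `(E₃, E₂)` is therefore `-1`.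
  have h3 := h _ _ h2 _ h1
  rw [inner_covDeriv _ _ _ h1, real_inner_comm _ (stdVec 2), inner_covDeriv _ _ _ h2] at h3
  have e : shearField.toFun = fun q : S2 => shearMap q := rfl
  rw [e, dirDeriv_shearMap h1, dirDeriv_shearMap h2] at h3
  simp [inner_eq_coord, stdVec] at h3

/-- The Killing equation is linear: if `X` and `X + tY` were both Killing with `t ≠ 0`, then so
would be `Y`, here the shear field. -/
theorem dense_not_isKilling : Dense {X : DivFreeField | ¬ IsKilling X.toFun} := by
  intro X
  by_cases hX : IsKilling X.toFun
  · refine mem_closure_of_tendsto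
      ((tendsto_addSMul X shearField).mono_left (nhdsWithin_le_nhds (s := {0}ᶜ))) ?_
    filter_upwards [self_mem_nhdsWithin] with t ht hK
    refine not_isKilling_shearField fun p u hu v hv => ?_
    have h1 := hX p u hu v hv
    have h2 : inner ℝ (covDeriv (fun q => X.toFun q + t • shearField.toFun q) p u) v
      + inner ℝ u (covDeriv (fun q => X.toFun q + t • shearField.toFun q) p v) = 0 :=
      hK p u hu v hv
    rw [covDeriv_add_smul X.smooth' shearField.smooth' t hu,
      covDeriv_add_smul X.smooth' shearField.smooth' t hv, inner_add_left, inner_add_right,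
      real_inner_smul_left, real_inner_smul_right] at h2
    have h3 : t * (inner ℝ (covDeriv shearField.toFun p u) v
        + inner ℝ u (covDeriv shearField.toFun p v)) = 0 := by linear_combination h2 - h1
    exact (mul_eq_zero.mp h3).resolve_left ht
  · exact subset_closure hX

end SphereSpin

end

theorem mainTheorem2 :
    (∀ X : SphereSpin.DivFreeField, ¬ SphereSpin.IsKilling X.toFun →
      ¬ SphereSpin.HasStrongChiralSymmetry X.toFun) ∧
    IsOpen {X : SphereSpin.DivFreeField | ¬ SphereSpin.IsKilling X.toFun} ∧
    Dense {X : SphereSpin.DivFreeField | ¬ SphereSpin.IsKilling X.toFun} :=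
  ⟨fun X hX h => hX (X.isKilling_of_hasStrongChiralSymmetry h),
    SphereSpin.isClosed_isKilling.isOpen_compl, SphereSpin.dense_not_isKilling⟩
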